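/- **Conventions.** A lattice point of $\mathbb R^m$ is a point of $\mathbb Z^m$. Polytopes $P\subset\mathbb R^m$ and $Q\subset\mathbb R^{m'}$ are isomorphic, $P\cong Q$, if there is an affine isomorphism between their affine hulls which maps $P$ onto $Q$ and maps the lattice points of $\operatorname{aff}(P)$ bijectively onto the lattice points of $\operatorname{aff}(Q)$. A $k$-dimensional lattice simplex $\operatorname{conv}(w_1,\dots,w_{k+1})\subset\mathbb R^m$ is basic if $w_1-w_{k+1},\dots,w_k-w_{k+1}$ is part of a lattice basis of $\mathbb Z^m$; it is empty if its vertices are its only lattice points. For a 5-dimensional lattice polytope $P\subset\mathbb R^5$ the polynomial $h^*_P$ is defined by $$1+\sum_{k\ge1}|kP\cap\mathbb Z^5|\,t^k=\frac{h^*_P(t)}{(1-t)^6}.$$ The Cayley polytope $\Sigma_1*\Sigma_2*\Sigma_3$ of polytopes $\Sigma_1,\Sigma_2,\Sigma_3\subset\mathbb R^3$ is the convex hull of $\bigcup_{i=1}^3 \{e_i\}\times\Sigma_i$ in $\mathbb R^3\times\mathbb R^3=\mathbb R^6$. For integers $a_1,a_2,n$ with $n>0$ and $\gcd(a_1a_2,n)=1$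 put $$\Delta(a_1,a_2,n):=\operatorname{conv}(0,e_1)*\operatorname{conv}(0,e_2)*\operatorname{conv}(0,(a_1,a_2,n)).$$ **Theorem.** Let $\Delta=\operatorname{conv}(v_1,\dots,v_6)\subset\mathbb R^5$ be a 5-dimensional lattice simplex with vertices $v_1,\dots,v_6$. Then the following statements are equivalent: - (1') $\Delta$ is empty, and the only lattice points of $2\Delta$ are the vertices of $2\Delta$ and the midpoints of the edges of $2\Delta$; - (3) $h^*_\Delta=1+(n-1)t^3$ for an integer $n\ge1$; - (4) all codimension 1 facets of $\Delta$ are basic lattice simplices, and $\Delta\cong\Delta_1*\Delta_2*\Delta_3$ for some 1-dimensional lattice simplices (lattice segments) $\Delta_1,\Delta_2,\Delta_3\subset\mathbb R^3$; - (5) $\Delta\cong\Delta(a_1,a_2,n)$ for some integers $a_1,a_2,n$ with $n>0$ and $\gcd(a_1a_2,n)=1$. In particular, if the codimension 1 facets of $\Delta$ are basic, then (1'), (3), (5) and the plain condition $\Delta\cong\Delta_1*\Delta_2*\Delta_3$ are equivalent. -/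

import Mathlib

open scoped Pointwise

namespace LatticePolytope

/-- The point of `ℝ^ι` with the given integer coordinates. -/
def toReal {ι : Type*} (x : ι → ℤ) : ι → ℝ := fun i => (x i : ℝ)

/-- The standard lattice `ℤ^ι` inside `ℝ^ι`. -/
def lattice (ι : Type*) : Set (ι → ℝ) := Set.range (toReal (ι := ι))

/-- The lattice polytope spanned by a family of lattice points; it is a simplex with the
members of the family as its vertices if the family is affinely independent. -/
def conv {ι κ : Type*} (v : κ → ι → ℤ) : Set (ι → ℝ) :=
  convexHull ℝ (Set.range fun i => toReal (v i))

/-- Isomorphism of polytopes `P ⊆ ℝ^ι` and `Q ⊆ ℝ^κ`: an affine isomorphism between the affine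
spaces spanned by `P` and `Q` (here the restriction of an affine map of the ambient spaces)
which maps `P` onto `Q` and respects the lattices. As `φ` maps the affine span of `P` onto the
affine span of `Q`, the last clause says that it maps the lattice points of the first affine space
bijectively onto the lattice points of the second one. -/
def Isomorphic {ι κ : Type*} (P : Set (ι → ℝ)) (Q : Set (κ → ℝ)) : Prop :=
  ∃ φ : (ι → ℝ) →ᵃ[ℝ] (κ → ℝ),
    Set.InjOn φ (affineSpan ℝ P : Set (ι → ℝ)) ∧ φ '' P = Q ∧
      ∀ x ∈ affineSpan ℝ P, φ x ∈ lattice κ ↔ x ∈ lattice ι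

/-- The lattice simplex with vertices `v` is empty: its only lattice points are its vertices. -/
def EmptySimplex {ι κ : Type*} (v : κ → ι → ℤ) : Prop :=
  conv v ∩ lattice ι = Set.range fun i => toReal (v i)

/-- Every lattice point of the multiple `2Δ` of the simplex `Δ` with vertices `v` is a vertex of
`2Δ` or the midpoint of an edge of `2Δ`. (The vertices of `2Δ` are the points `2 v i`, and the
edges are the segments between two different vertices.) -/
def DoubleOnlyVerticesAndMidpoints {ι κ : Type*} (v : κ → ι → ℤ) : Prop :=
  ∀ x ∈ ((2 : ℝ) • conv v) ∩ lattice ι,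
    (∃ i, x = (2 : ℝ) • toReal (v i)) ∨
      ∃ i j, i ≠ j ∧ x = midpoint ℝ ((2 : ℝ) • toReal (v i)) ((2 : ℝ) • toReal (v j))

/-- The lattice simplex in `ℝ^d` with vertices `v 0, …, v k` is basic: the differences
`v 0 - v k, …, v (k-1) - v k` are part of a lattice basis of `ℤ^d`. -/
def BasicSimplex {d k : ℕ} (v : Fin (k + 1) → Fin d → ℤ) : Prop :=
  ∃ (b : Module.Basis (Fin d) ℤ (Fin d → ℤ)) (f : Fin k ↪ Fin d),
    ∀ i : Fin k, v i.castSucc - v (Fin.last k) = b (f i)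

/-- All codimension one facets of the simplex with vertices `v` are basic; the facets are obtained
by leaving out one vertex. -/
def FacetsBasic {d k : ℕ} (v : Fin (k + 2) → Fin d → ℤ) : Prop :=
  ∀ j : Fin (k + 2), BasicSimplex fun i : Fin (k + 1) => v (j.succAbove i)

/-- The Ehrhart series `1 + ∑_{k ≥ 1} |kP ∩ ℤ^d| t^k`. -/
noncomputable def ehrhartSeries {d : ℕ} (P : Set (Fin d → ℝ)) : PowerSeries ℤ :=
  PowerSeries.mk fun k =>
    if k = 0 then 1 else ((((k : ℝ) • P) ∩ lattice (Fin d)).ncard : ℤ)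

/-- The `h*`-polynomial of a `d`-dimensional lattice polytope `P` in `ℝ^d`: the numerator of the
Ehrhart series written with the denominator `(1 - t)^(d+1)`, as a formal power series. -/
noncomputable def hStar {d : ℕ} (P : Set (Fin d → ℝ)) : PowerSeries ℤ :=
  (1 - PowerSeries.X) ^ (d + 1) * ehrhartSeries P

/-- The Cayley polytope `S 1 * … * S r` in `ℝ^(r+d) = ℝ^r × ℝ^d`: the convex hull of the polytopes
`e_i × S i`. -/
def cayley {r d : ℕ} (S : Fin r → Set (Fin d → ℝ)) : Set (Fin r ⊕ Fin d → ℝ) :=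
  convexHull ℝ (⋃ i, (fun x => Sum.elim (Pi.single i (1 : ℝ)) x) '' S i)

/-- The lattice segment with end points `p` and `q`. -/
def latticeSegment {ι : Type*} (p q : ι → ℤ) : Set (ι → ℝ) := segment ℝ (toReal p) (toReal q)

/-- The Cayley polytope `Δ(a₁, a₂, n)` of the three segments `conv(0, e₁)`, `conv(0, e₂)` and
`conv(0, (a₁, a₂, n))` in `ℝ^3`. -/
def whiteSimplex (a₁ a₂ n : ℤ) : Set (Fin 3 ⊕ Fin 3 → ℝ) :=
  cayley ![latticeSegment 0 ![1, 0, 0], latticeSegment 0 ![0, 1, 0],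
    latticeSegment 0 ![a₁, a₂, n]]

end LatticePolytope

/-! Describe points by coefficient vectors x ∈ ℝ⁶ on the vertices. Those with integral sum and
integral image form a group L = `baryLattice v` containing ℤ⁶, and L up to relabelling is the
isomorphism type of the simplex (`Isomorphic.exists_equiv`, `isomorphic_of_mem_baryLattice_iff`).
All conditions are compared with `Balanced`: every nonzero element of L in [0,1)⁶ has coordinate sum
3.

The condition on Δ and 2Δ excludes sums 1 and 2, and the involution taking x to the fractional part
of -x upgrades "at least 3" to "exactly 3". Splitting coefficients into fractional and integral
parts then gives h*; conversely, the lattice point counts of Δ and 2Δ recover the first condition.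
The same involution shows that one integral coordinate forces all to be integral
(`Balanced.mem_ints`). Hence the facets are basic, and L/ℤ⁶ is cyclic, generated by some c/n with
every c i prime to n.

The deep step is to pair the c i into opposite residues mod n. Balancedness makes the sawtooth sums
over k·c i/n vanish whenever n ∤ k. Weighting them with an odd character splits off a generalised
Bernoulli number, which is nonzero because L(1, χ) ≠ 0. So ∑ χ(c i) = 0 for all odd χ, and
orthogonality makes the multiset of residues symmetric under negation. A pairing is a Cayley
structure, and inverting one c i mod n yields a₁ and a₂. Conversely, pair sums are integral in a
Cayley polytope of segments, so a box point without zero coordinates has three pair sums equal to 1.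
-/

/-! ### Exponential zeta values at 1 and nonvanishing of generalised Bernoulli numbers -/

open Complex Set Filter Topology MeasureTheory in
/-- The function `t ↦ w / (1 - w)` with `w = z e^{-t}` is the derivative of `log (1 - w)`. -/
theorem hasDerivAt_log_one_sub_mul_exp_neg {z : ℂ} (hz : ‖z‖ = 1) (hz1 : z ≠ 1) {t : ℝ}
    (ht : 0 ≤ t) :
    HasDerivAt (fun t : ℝ => Complex.log (1 - z * cexp (-t)))
      (z * cexp (-t) / (1 - z * cexp (-t))) t := by
  -- As w = z e^{-t} lies in the closed unit disc, 1 - w can leave the slit plane only at w = 1,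
  -- which forces t = 0 and z = 1.
  have hmem : 1 - z * cexp (-t) ∈ Complex.slitPlane := by
    rw [Complex.mem_slitPlane_iff]
    by_contra! hcon
    have hn : ‖z * cexp (-t)‖ ≤ 1 := by
      rw [norm_mul, hz, one_mul, Complex.norm_exp]
      simpa using ht
    set w := z * cexp (-t) with hw
    have h1 : w.im = 0 := by simpa using hcon.2
    have h2 : 1 ≤ w.re := by simpa using hcon.1
    have hw1 : w = 1 := by
      apply Complex.ext
      · have := Complex.re_le_norm w
        simp; linarith
      · simpa using h1
    have : ‖cexp (-t)‖ = 1 := by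
      have := congrArg norm hw1
      rwa [hw, norm_mul, hz, one_mul, norm_one] at this
    rw [Complex.norm_exp] at this
    have ht0 : t = 0 := by simpa using this
    apply hz1
    rw [hw, ht0] at hw1
    simpa using hw1
  have h1 : HasDerivAt (fun t : ℝ => 1 - z * cexp (-t)) (z * cexp (-t)) t := by
    have h2 : HasDerivAt (fun t : ℝ => -(t : ℂ)) (-1) t := (Complex.ofRealCLM.hasDerivAt).neg
    have := (h2.cexp.const_mul z).const_sub 1
    simpa using this
  exact h1.clog_real hmem

open Complex Set Filter Topology MeasureTheory HurwitzZeta in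
/-- The value at `1` of the exponential zeta function. -/
theorem expZeta_one {x : ℝ} (hx : (x : UnitAddCircle) ≠ 0) :
    expZeta x 1 = -Complex.log (1 - cexp (2 * Real.pi * I * x)) := by
  set z := cexp (2 * Real.pi * I * x) with hz
  have hzn : ‖z‖ = 1 := by
    rw [hz, show 2 * (Real.pi : ℂ) * I * x = ((2 * Real.pi * x : ℝ) : ℂ) * I by push_cast; ring,
      Complex.norm_exp_ofReal_mul_I]
  have hz1 : z ≠ 1 := by
    intro h
    rw [hz, Complex.exp_eq_one_iff] at h
    obtain ⟨n, hn⟩ := h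
    apply hx
    have : x = n := by
      have h2 : (2 * (Real.pi : ℂ) * I) ≠ 0 := Complex.two_pi_I_ne_zero
      have : (2 * (Real.pi : ℂ) * I) * (x : ℂ) = (2 * (Real.pi : ℂ) * I) * n := by
        rw [hn]; ring
      exact_mod_cast mul_left_cancel₀ h2 this
    rw [this]
    exact (AddCircle.coe_eq_zero_iff 1).mpr ⟨n, by simp⟩
  have hwn (t : ℝ) : ‖z * cexp (-t)‖ = Real.exp (-t) := by
    rw [norm_mul, hzn, one_mul, Complex.norm_exp]; simp
  set F : ℝ → ℂ := fun t => z * cexp (-t) / (1 - z * cexp (-t)) with hF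
  have hden (t : ℝ) (ht : 0 ≤ t) : 1 - z * cexp (-t) ≠ 0 := by
    intro h
    have h1 : z * cexp (-t) = 1 := (sub_eq_zero.mp h).symm
    have h2 := hwn t
    rw [h1, norm_one] at h2
    have : t = 0 := by
      have := h2.symm
      simpa using this
    rw [this] at h1
    exact hz1 (by simpa using h1)
  have hcont : ContinuousOn F (Ici 0) := by
    apply ContinuousOn.div
    · fun_prop
    · fun_prop
    · intro t ht; exact hden t ht
  have htop : F =O[atTop] fun t => Real.exp (-1 * t) := by
    refine Asymptotics.IsBigO.of_bound 2 ?_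
    filter_upwards [eventually_ge_atTop (1 : ℝ)] with t ht
    have he : Real.exp (-t) ≤ 1 / 2 := by
      have h1 : Real.exp (-t) ≤ Real.exp (-1) := Real.exp_le_exp.mpr (by linarith)
      have h2 : Real.exp (-1) ≤ 1 / 2 := by
        have := Real.exp_one_gt_d9
        rw [Real.exp_neg, inv_eq_one_div]
        apply one_div_le_one_div_of_le <;> linarith
      linarith
    have hd : 1 / 2 ≤ ‖1 - z * cexp (-t)‖ := by
      have := norm_sub_norm_le (1 : ℂ) (z * cexp (-t))
      rw [hwn, norm_one] at this
      linarith
    rw [hF]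
    simp only
    rw [norm_div, hwn, Real.norm_of_nonneg (Real.exp_pos _).le, div_le_iff₀ (by linarith)]
    have := Real.exp_pos (-t)
    rw [neg_one_mul]
    nlinarith
  have hbot : F =O[𝓝[>] 0] fun t : ℝ => t ^ (-(0 : ℝ)) := by
    have h1 : Tendsto F (𝓝[>] 0) (𝓝 (F 0)) :=
      (hcont 0 (by simp)).tendsto.mono_left (nhdsWithin_mono _ Ioi_subset_Ici_self)
    simpa using h1.isBigO_one ℝ
  have hli : LocallyIntegrableOn F (Ioi 0) :=
    (hcont.mono Ioi_subset_Ici_self).locallyIntegrableOn measurableSet_Ioi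
  have hmellin1 : mellin F 1 = -Complex.log (1 - z) := by
    have hconv : MellinConvergent F 1 :=
      mellinConvergent_of_isBigO_rpow_exp one_pos hli htop hbot (by simp)
    have hint : IntegrableOn F (Ioi 0) := by
      simpa [MellinConvergent] using hconv
    have hlim : Tendsto (fun t : ℝ => Complex.log (1 - z * cexp (-t))) atTop (𝓝 0) := by
      have h0 : Tendsto (fun t : ℝ => z * cexp (-t)) atTop (𝓝 0) := by
        rw [tendsto_zero_iff_norm_tendsto_zero]
        simp_rw [hwn]
        exact Real.tendsto_exp_neg_atTop_nhds_zero
      have h1 : Tendsto (fun t : ℝ => 1 - z * cexp (-t)) atTop (𝓝 1) := by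
        simpa using h0.const_sub 1
      simpa using h1.clog (by simp)
    have := integral_Ioi_of_hasDerivAt_of_tendsto'
      (fun t ht => hasDerivAt_log_one_sub_mul_exp_neg hzn hz1 ht) hint hlim
    simpa [mellin] using this
  -- Expand F as the geometric series of zⁿ e^{-nt} over n ≥ 1 and integrate termwise. Absolute
  -- convergence needs s > 1; the value at 1 follows by continuity of both sides.
  have hs (s : ℝ) (hs : 1 < s) : Complex.Gamma s * expZeta x s = mellin F s := by
    have h1 := (hasSum_expZeta_of_one_lt_re x (s := s) (by simpa using hs)).mul_left
      (Complex.Gamma s)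
    have h2 := hasSum_mellin (a := fun n : ℕ => if n = 0 then 0 else z ^ n)
      (p := fun n : ℕ => (n : ℝ)) (F := F) (s := s)
      (by intro i; by_cases h : i = 0
          · simp [h]
          · right; exact_mod_cast Nat.pos_of_ne_zero h)
      (by simp; linarith)
      (by
        intro t ht
        have hlt : ‖z * cexp (-t)‖ < 1 := by
          rw [hwn]
          simpa using ht
        have := (hasSum_geometric_of_norm_lt_one hlt).mul_left (z * cexp (-t))
        rw [← div_eq_mul_inv] at this
        rw [← hasSum_nat_add_iff' 1]
        simp only [Finset.range_one, Finset.sum_singleton, if_true, zero_mul, sub_zero]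
        convert! this using 1
        funext n
        simp only [Nat.add_eq_zero_iff, one_ne_zero, and_false, if_false]
        have e : cexp (-t) ^ (n + 1) = cexp ↑(-((n + 1 : ℕ) : ℝ) * t) := by
          rw [← Complex.exp_nat_mul]
          push_cast
          ring_nf
        rw [Complex.ofReal_exp, ← e]
        ring)
      (by
        have : Summable fun n : ℕ => 1 / (n : ℝ) ^ s := Real.summable_one_div_nat_rpow.mpr hs
        refine this.of_nonneg_of_le (fun n => by positivity) (fun n => ?_)
        by_cases h : n = 0
        · simp [h]; positivity
        · simp [h, hzn])
    refine (h1.unique ?_)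
    convert! h2 using 1
    funext n
    by_cases h : n = 0
    · have : (s : ℂ) ≠ 0 := by exact_mod_cast (by linarith : s ≠ 0)
      simp [h, this]
    · simp only [h, if_false]
      rw [hz, ← Complex.exp_nat_mul, mul_div_assoc]
      push_cast
      ring_nf
  have hc1 : ContinuousAt (fun s : ℂ => Complex.Gamma s * expZeta x s) 1 := by
    refine ((Complex.differentiableAt_Gamma 1 ?_).mul
      (differentiableAt_expZeta x 1 (Or.inr hx))).continuousAt
    intro m h
    have := congrArg Complex.re h
    simp at this
    have h0 : (0 : ℝ) ≤ m := Nat.cast_nonneg m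
    linarith
  have hc2 : ContinuousAt (mellin F) 1 :=
    (mellin_differentiableAt_of_isBigO_rpow_exp one_pos hli htop hbot (by simp)).continuousAt
  have hof : Tendsto (fun s : ℝ => (s : ℂ)) (𝓝[>] 1) (𝓝 1) := by
    have : Tendsto (fun s : ℝ => (s : ℂ)) (𝓝 1) (𝓝 ((1 : ℝ) : ℂ)) :=
      Complex.continuous_ofReal.tendsto 1
    simpa using this.mono_left nhdsWithin_le_nhds
  have ht1 := hc1.tendsto.comp hof
  have ht2 := hc2.tendsto.comp hof
  have heq := tendsto_nhds_unique_of_eventuallyEq ht1 ht2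
    (by filter_upwards [self_mem_nhdsWithin] with s hs1 using hs s hs1)
  rw [Complex.Gamma_one, one_mul, hmellin1] at heq
  exact heq

open Complex HurwitzZeta in
/-- The Fourier expansion of the first Bernoulli polynomial, in terms of the exponential zeta
function. -/
theorem expZeta_one_sub_expZeta_neg_one {x : ℝ} (hx0 : 0 < x) (hx1 : x < 1) :
    expZeta x 1 - expZeta (-(x : UnitAddCircle)) 1 = 2 * Real.pi * I * (1 / 2 - x) := by
  have hx : (x : UnitAddCircle) ≠ 0 := by
    intro h
    obtain ⟨n, hn⟩ := (AddCircle.coe_eq_zero_iff 1).mp h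
    rw [zsmul_one] at hn
    rw [← hn] at hx0 hx1
    have h0 : 0 < n := by exact_mod_cast hx0
    have h1 : n < 1 := by exact_mod_cast hx1
    omega
  have hsin : 0 < 2 * Real.sin (Real.pi * x) := by
    have := Real.sin_pos_of_pos_of_lt_pi (x := Real.pi * x) (by positivity)
      (by nlinarith [Real.pi_pos])
    linarith
  -- Polar form of 1 - e^{2πiy}. For y = x and y = -x the moduli agree and the angles are opposite,
  -- so only the angle survives in the difference of the logarithms.
  have key (y : ℝ) (θ : ℝ) (h1 : -Real.pi < θ) (h2 : θ ≤ Real.pi)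
      (h : 1 - cexp (2 * Real.pi * I * y) = (2 * Real.sin (Real.pi * x) : ℝ) * cexp (θ * I)) :
      Complex.log (1 - cexp (2 * Real.pi * I * y)) =
        Real.log (2 * Real.sin (Real.pi * x)) + θ * I := by
    rw [h, Complex.log_ofReal_mul hsin (Complex.exp_ne_zero _), Complex.log_exp]
    · simpa using h1
    · simpa using h2
  have hpi := Real.pi_pos
  have hsin2 : ((2 * Real.sin (Real.pi * x) : ℝ) : ℂ) =
      (cexp (-(Real.pi * x * I)) - cexp (Real.pi * x * I)) * I := by
    push_cast
    rw [Complex.sin]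
    ring_nf
  have ha := key x (Real.pi * x - Real.pi / 2) (by nlinarith) (by nlinarith) (by
    rw [hsin2]
    push_cast
    rw [sub_mul (Real.pi * x : ℂ), Complex.exp_sub, Complex.exp_pi_div_two_mul_I,
      show (2 * (Real.pi : ℂ) * I * x) = Real.pi * x * I + Real.pi * x * I by ring,
      Complex.exp_add, Complex.exp_neg]
    have := Complex.exp_ne_zero (Real.pi * x * I)
    field_simp)
  have hb := key (-x) (-(Real.pi * x - Real.pi / 2)) (by nlinarith) (by nlinarith) (by
    rw [hsin2]
    push_cast
    rw [neg_sub, sub_mul (Real.pi / 2 : ℂ), Complex.exp_sub, Complex.exp_pi_div_two_mul_I,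
      show (2 * (Real.pi : ℂ) * I * -x) = -(Real.pi * x * I) + -(Real.pi * x * I) by ring,
      Complex.exp_add, Complex.exp_neg]
    have := Complex.exp_ne_zero (Real.pi * x * I)
    field_simp
    rw [I_sq]
    ring)
  rw [← AddCircle.coe_neg, expZeta_one hx, expZeta_one (by rwa [AddCircle.coe_neg, neg_ne_zero]),
    ha, hb]
  push_cast
  ring

open Complex HurwitzZeta ZMod in
/-- The generalised Bernoulli number `B_{1,χ}` of a primitive odd Dirichlet character does not
vanish. -/
theorem DirichletCharacter.IsPrimitive.sum_mul_val_ne_zero {N : ℕ} [NeZero N]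
    {χ : DirichletCharacter ℂ N} (hχ : χ.IsPrimitive) (hodd : χ.Odd) :
    ∑ j : ZMod N, χ j * ((j.val : ℂ) / N - 1 / 2) ≠ 0 := by
  intro h0
  have hN : N ≠ 1 := by
    rintro rfl
    have h1 : χ (-1) = -1 := hodd
    rw [show (-1 : ZMod 1) = 1 from Subsingleton.elim _ _, map_one] at h1
    norm_num at h1
  have hχ0 : χ 0 = 0 := χ.map_zero' hN
  have hne : χ⁻¹ ≠ 1 := by
    intro h
    have h1 : χ = 1 := inv_eq_one.mp h
    have h2 : χ (-1) = -1 := hodd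
    rw [h1, MulChar.one_apply isUnit_one.neg] at h2
    norm_num at h2
  have hL := DirichletCharacter.LFunction_apply_one_ne_zero hne
  set S := ∑ j : ZMod N, χ j * expZeta (toAddCircle (-j)) 1 with hS
  have hdft : ZMod.LFunction (𝓕 χ) 1 = S := LFunction_dft _ (Or.inl hχ0)
  have hneg : S = ∑ j : ZMod N, -(χ j * expZeta (toAddCircle j) 1) := by
    rw [hS, ← Equiv.sum_comp (Equiv.neg (ZMod N))]
    refine Finset.sum_congr rfl fun j _ => ?_
    rw [Equiv.neg_apply, neg_neg, hodd.to_fun j, neg_mul]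
  have hS0 : S = 0 := by
    -- Oddness of χ antisymmetrises the zeta values, whose odd part is the sawtooth function; the
    -- assumed vanishing thus gives S = 0.
    have h2 : S + S = -(2 * Real.pi * I) * ∑ j : ZMod N, χ j * (1 / 2 - (j.val : ℂ) / N) := by
      nth_rewrite 2 [hneg]
      rw [hS, ← Finset.sum_add_distrib, Finset.mul_sum]
      refine Finset.sum_congr rfl fun j _ => ?_
      rcases eq_or_ne j 0 with rfl | hj
      · simp [hχ0]
      have hval : 0 < j.val := Nat.pos_of_ne_zero (by rwa [Ne, ZMod.val_eq_zero])
      have hNpos : (0 : ℝ) < N := by exact_mod_cast Nat.pos_of_ne_zero (NeZero.ne N)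
      have key := expZeta_one_sub_expZeta_neg_one (x := (j.val : ℝ) / N)
        (by positivity) (by rw [div_lt_one hNpos]; exact_mod_cast j.val_lt)
      rw [← toAddCircle_apply j, ← map_neg] at key
      push_cast at key
      linear_combination (-χ j) * key
    have h3 : ∑ j : ZMod N, χ j * (1 / 2 - (j.val : ℂ) / N) =
        -∑ j : ZMod N, χ j * ((j.val : ℂ) / N - 1 / 2) := by
      rw [← Finset.sum_neg_distrib]
      exact Finset.sum_congr rfl fun j _ => by ring
    rw [h3, h0] at h2
    linear_combination h2 / 2
  -- For primitive χ the Fourier transform is a multiple of χ⁻¹. Since L(χ⁻¹, 1) ≠ 0, S = 0 kills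
  -- the Gauss sum, hence 𝓕 χ and finally χ itself.
  have hconst : (𝓕 (χ : ZMod N → ℂ)) =
      fun j => (χ (-1) * gaussSum χ stdAddChar) * χ⁻¹ j := by
    funext j
    rw [hχ.fourierTransform_eq_inv_mul_gaussSum, ← neg_one_mul j, map_mul]
    have : χ⁻¹ (-1) = χ (-1) := by
      rw [MulChar.inv_apply_eq_inv', show χ (-1) = -1 from hodd]
      norm_num
    rw [this]
    ring
  have hscale : ZMod.LFunction (𝓕 (χ : ZMod N → ℂ)) 1 =
      (χ (-1) * gaussSum χ stdAddChar) * DirichletCharacter.LFunction χ⁻¹ 1 := by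
    rw [hconst, DirichletCharacter.LFunction, ZMod.LFunction, ZMod.LFunction]
    simp_rw [Finset.mul_sum]
    refine Finset.sum_congr rfl fun j _ => by ring
  have hg : gaussSum χ stdAddChar = 0 := by
    rw [hdft, hS0, show χ (-1) = -1 from hodd] at hscale
    have h4 := mul_eq_zero.mp hscale.symm
    rcases h4 with h4 | h4
    · simpa using h4
    · exact absurd h4 hL
  have hzero : 𝓕 (χ : ZMod N → ℂ) = 0 := by
    rw [hconst, hg]
    funext j
    simp
  have hz : (χ : ZMod N → ℂ) = 0 := by
    rwa [EmbeddingLike.map_eq_zero_iff] at hzero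
  have := congrFun hz 1
  simp at this

/-! ### From vanishing sawtooth sums to a pairing of residues -/

open Complex in
/-- If the sums of the sawtooth function over the multiples of the `c i / n` vanish, then every
odd character has sum zero over the `c i`. -/
theorem DirichletCharacter.Odd.sum_eq_zero_of_sum_fract {ι : Type*} [Fintype ι] {n : ℕ} [NeZero n]
    (c : ι → ℤ) (hc : ∀ i, IsCoprime (c i) n)
    (h : ∀ k : ℤ, ¬ (n : ℤ) ∣ k → ∑ i, (Int.fract ((k * c i : ℤ) / (n : ℝ)) - 1 / 2) = 0)
    {χ : DirichletCharacter ℂ n} (hodd : χ.Odd) : ∑ i, χ (c i) = 0 := by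
  set f := χ.conductor with hf
  obtain ⟨m, hm⟩ := χ.conductor_dvd_level
  rw [← hf] at hm
  have hn0 : n ≠ 0 := NeZero.ne n
  have hf0 : f ≠ 0 := by rintro h0; rw [h0, zero_mul] at hm; exact hn0 hm
  have hm0 : m ≠ 0 := by rintro h0; rw [h0, mul_zero] at hm; exact hn0 hm
  have : NeZero f := ⟨hf0⟩
  have hcf (i : ι) : IsCoprime (c i) f := by
    have := hc i
    rw [hm] at this
    push_cast at this
    exact this.of_mul_right_left
  -- The Bernoulli number is known to be nonzero only for primitive characters, so the argument
  -- descends to the conductor f, where n = f m; the multiples k = m j turn fractions over n into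
  -- fractions over f.
  set ψ : DirichletCharacter ℂ f := χ.primitiveCharacter with hψ
  have hψodd : ψ.Odd := by
    have h1 := χ.primitiveCharacter_apply_of_isCoprime (a := -1) isCoprime_one_left.neg_left
    push_cast at h1
    exact h1.trans hodd
  have hinv : (ψ⁻¹).Odd := by
    change ψ⁻¹ (-1) = -1
    rw [MulChar.inv_apply_eq_inv', show ψ (-1) = -1 from hψodd]
    norm_num
  have hψprim : (ψ⁻¹).IsPrimitive := by
    rw [DirichletCharacter.isPrimitive_def, DirichletCharacter.conductor_inv]
    exact χ.primitiveCharacter_isPrimitive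
  have hB := hψprim.sum_mul_val_ne_zero hinv
  have hf1 : f ≠ 1 := by
    intro hf1
    have h1 : ψ = 1 := DirichletCharacter.level_one' ψ hf1
    have h2 : ψ (-1) = -1 := hψodd
    rw [h1, MulChar.one_apply isUnit_one.neg] at h2
    norm_num at h2
  have hsum (j : ZMod f) (hj : j ≠ 0) :
      ∑ i, (((j * (c i : ZMod f)).val : ℂ) / f - 1 / 2) = 0 := by
    have h1 := h (m * j.val) (by
      rw [hm]
      push_cast
      rw [mul_comm]
      intro hdvd
      have := Int.dvd_of_mul_dvd_mul_left (by exact_mod_cast hm0) hdvd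
      apply hj
      rw [← ZMod.natCast_zmod_val j]
      rw [ZMod.natCast_eq_zero_iff]
      exact_mod_cast this)
    rw [← Complex.ofReal_inj] at h1
    push_cast at h1
    rw [← h1]
    refine Finset.sum_congr rfl fun i _ => ?_
    congr 1
    have h2 : (((m : ℤ) * j.val * c i : ℤ) : ℝ) / (n : ℝ) = ((j.val * c i : ℤ) : ℝ) / (f : ℕ) := by
      rw [hm]
      push_cast
      have : (m : ℝ) ≠ 0 := by exact_mod_cast hm0
      have : (f : ℝ) ≠ 0 := by exact_mod_cast hf0
      field_simp
    have h3 : Int.fract (((j.val * c i : ℤ) : ℝ) / (f : ℕ)) =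
        ((j * (c i : ZMod f)).val : ℝ) / f := by
      rw [Int.fract_div_intCast_eq_div_intCast_mod]
      congr 1
      have h4 : (((j.val * c i : ℤ)) : ZMod f) = j * c i := by simp
      rw [← h4]
      have := ZMod.val_intCast (n := f) (j.val * c i : ℤ)
      exact_mod_cast this.symm
    push_cast at h2 h3
    rw [h2, h3]
    push_cast
    rfl
  -- Substituting j ↦ j·c i in the Bernoulli sum absorbs the factor ψ(c i); exchanging the sums
  -- leaves the vanishing sawtooth sum for each j ≠ 0.
  have hprod : (∑ i, ψ (c i)) * ∑ j : ZMod f, ψ⁻¹ j * ((j.val : ℂ) / f - 1 / 2) = 0 := by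
    have hi (i : ι) : ψ (c i) * ∑ j : ZMod f, ψ⁻¹ j * ((j.val : ℂ) / f - 1 / 2) =
        ∑ j : ZMod f, ψ⁻¹ j * (((j * (c i : ZMod f)).val : ℂ) / f - 1 / 2) := by
      have hu : IsUnit ((c i : ℤ) : ZMod f) := by
        rw [← ZMod.coe_unitOfIsCoprime _ (hcf i)]
        exact Units.isUnit _
      rw [← Equiv.sum_comp (Units.mulRight hu.unit), Finset.mul_sum]
      refine Finset.sum_congr rfl fun j _ => ?_
      have h5 : ψ (c i) * ψ⁻¹ (c i) = 1 := by
        rw [← MulChar.mul_apply, mul_inv_cancel, MulChar.one_apply hu]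
      rw [Units.mulRight_apply, IsUnit.unit_spec, map_mul]
      linear_combination (ψ⁻¹ j * (((j * (c i : ZMod f)).val : ℂ) / f - 1 / 2)) * h5
    rw [Finset.sum_mul]
    simp_rw [hi]
    rw [Finset.sum_comm]
    refine Finset.sum_eq_zero fun j _ => ?_
    rw [← Finset.mul_sum]
    rcases eq_or_ne j 0 with rfl | hj
    · rw [DirichletCharacter.map_zero' _ hf1, zero_mul]
    · rw [hsum j hj, mul_zero]
  have h6 : ∑ i, ψ (c i) = 0 := by
    rcases mul_eq_zero.mp hprod with h | h
    · exact h
    · exact absurd h hB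
  rw [← h6]
  exact Finset.sum_congr rfl fun i _ => (χ.primitiveCharacter_apply_of_isCoprime (hc i)).symm

/-- If all odd characters have sum zero over a family of units, then the family is symmetric. -/
theorem ZMod.card_filter_eq_card_filter_neg {ι : Type*} [Fintype ι] {n : ℕ} [NeZero n]
    (c : ι → ZMod n) (h : ∀ χ : DirichletCharacter ℂ n, χ.Odd → ∑ i, χ (c i) = 0)
    {a : ZMod n} (ha : IsUnit a) :
    (Finset.univ.filter fun i => c i = a).card = (Finset.univ.filter fun i => c i = -a).card := by
  classical
  have key (b : ZMod n) (hb : IsUnit b) :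
      ∑ χ : DirichletCharacter ℂ n, χ b⁻¹ * ∑ i, χ (c i) =
        (n.totient : ℂ) * (Finset.univ.filter fun i => c i = b).card := by
    simp_rw [Finset.mul_sum]
    rw [Finset.sum_comm]
    simp_rw [DirichletCharacter.sum_char_inv_mul_char_eq ℂ hb]
    rw [← Finset.sum_filter, Finset.sum_const, nsmul_eq_mul, mul_comm]
    simp_rw [eq_comm (a := b)]
  have h1 := key a ha
  have h2 := key (-a) ha.neg
  -- Even characters do not distinguish a from -a, and odd ones contribute zero by hypothesis.
  have h3 : ∑ χ : DirichletCharacter ℂ n, χ a⁻¹ * ∑ i, χ (c i) =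
      ∑ χ : DirichletCharacter ℂ n, χ (-a)⁻¹ * ∑ i, χ (c i) := by
    refine Finset.sum_congr rfl fun χ _ => ?_
    rcases χ.even_or_odd with hχ | hχ
    · have : (-a)⁻¹ = -a⁻¹ := by
        have h4 : -a * (-a)⁻¹ = 1 := ZMod.mul_inv_of_unit _ ha.neg
        have h5 : a * a⁻¹ = 1 := ZMod.mul_inv_of_unit _ ha
        linear_combination (-a⁻¹) * h4 - (-a)⁻¹ * h5
      rw [this, hχ.eval_neg]
    · rw [h χ hχ, mul_zero, mul_zero]
  rw [h1, h2] at h3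
  have ht : (n.totient : ℂ) ≠ 0 := by
    exact_mod_cast (Nat.totient_pos.mpr (Nat.pos_of_ne_zero (NeZero.ne n))).ne'
  exact_mod_cast mul_left_cancel₀ ht h3

/-- A symmetric family without self-opposite members splits into pairs of opposite members. -/
theorem exists_pairing_of_card_filter_eq {ι G : Type*} [DecidableEq ι] [DecidableEq G]
    [AddGroup G] (c : ι → G) (hne : ∀ i, c i ≠ -c i) (m : ℕ) (S : Finset ι) (hS : S.card = 2 * m)
    (h : ∀ a, (S.filter fun i => c i = a).card = (S.filter fun i => c i = -a).card) :
    ∃ σ : Fin m ⊕ Fin m → ι, Function.Injective σ ∧ (∀ i, σ i ∈ S) ∧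
      ∀ i, c (σ (Sum.inl i)) = -c (σ (Sum.inr i)) := by
  induction m generalizing S with
  | zero => exact ⟨fun i => (i.elim Fin.elim0 Fin.elim0), fun i => (i.elim Fin.elim0 Fin.elim0),
      fun i => (i.elim Fin.elim0 Fin.elim0), fun i => Fin.elim0 i⟩
  | succ m ih =>
    obtain ⟨q, hq⟩ : S.Nonempty := by
      rw [← Finset.card_pos, hS]; omega
    obtain ⟨p, hp⟩ : (S.filter fun i => c i = -c q).Nonempty := by
      rw [← Finset.card_pos, ← h, Finset.card_pos]
      exact ⟨q, by simp [hq]⟩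
    rw [Finset.mem_filter] at hp
    have hpq : p ≠ q := by
      rintro rfl
      exact hne _ hp.2
    have hpe : p ∈ S.erase q := Finset.mem_erase.mpr ⟨hpq, hp.1⟩
    obtain ⟨σ, hσ1, hσ2, hσ3⟩ := ih ((S.erase q).erase p)
      (by rw [Finset.card_erase_of_mem hpe, Finset.card_erase_of_mem hq, hS]; omega)
      (by
        intro a
        simp only [Finset.filter_erase, Finset.card_erase_eq_ite, Finset.mem_erase,
          Finset.mem_filter, hp.1, hq, hp.2, ne_eq, hpq, not_false_eq_true, true_and, neg_inj, h a,
          neg_eq_iff_eq_neg (b := a)]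
        by_cases h1 : c q = a <;> by_cases h2 : c q = -a <;> simp [h1, h2] <;>
          split_ifs <;> grind)
    have hσS (i) : σ i ≠ p ∧ σ i ≠ q ∧ σ i ∈ S := by
      have := hσ2 i
      simpa [Finset.mem_erase] using this
    refine ⟨Sum.elim (Fin.cons p (σ ∘ Sum.inl)) (Fin.cons q (σ ∘ Sum.inr)), ?_, ?_, ?_⟩
    · refine Function.Injective.sumElim ?_ ?_ ?_
      · rw [Fin.cons_injective_iff]
        exact ⟨by rintro ⟨i, hi⟩; exact (hσS _).1 hi, hσ1.comp Sum.inl_injective⟩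
      · rw [Fin.cons_injective_iff]
        exact ⟨by rintro ⟨i, hi⟩; exact (hσS _).2.1 hi, hσ1.comp Sum.inr_injective⟩
      · intro i j
        refine Fin.cases ?_ (fun i => ?_) i <;> refine Fin.cases ?_ (fun j => ?_) j
        · simpa using hpq
        · simpa using (hσS _).1.symm
        · simpa using (hσS _).2.1
        · simpa using hσ1.ne (by simp)
    · rintro (i | i) <;> refine Fin.cases ?_ (fun i => ?_) i <;> simp [hp.1, hq, hσS]
    · intro i
      refine Fin.cases ?_ (fun i => ?_) i
      · simpa using hp.2
      · simpa using hσ3 i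

/-- The number theoretic core: if the sawtooth sums of all multiples of `(c i / n)` vanish, then the
`c i` can be paired such that the sum of each pair is divisible by `n`. -/
theorem exists_pairing_of_sum_fract_eq (n : ℕ) (hn : 0 < n) (c : Fin 6 → ℤ)
    (hc : ∀ i, IsCoprime (c i) n)
    (h : ∀ k : ℤ, ¬ (n : ℤ) ∣ k → ∑ i, Int.fract ((k * c i : ℤ) / (n : ℝ)) = 3) :
    ∃ σ : Fin 3 ⊕ Fin 3 ≃ Fin 6, ∀ i, (n : ℤ) ∣ c (σ (Sum.inl i)) + c (σ (Sum.inr i)) := by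
  classical
  have : NeZero n := ⟨hn.ne'⟩
  have hu (i : Fin 6) : IsUnit ((c i : ℤ) : ZMod n) := by
    rw [← ZMod.coe_unitOfIsCoprime _ (hc i)]
    exact Units.isUnit _
  -- Here every unit is its own negative, so any pairing works; for n > 2 no unit is, as the general
  -- pairing lemma requires.
  by_cases hn2 : n ≤ 2
  · let e : Fin 3 ⊕ Fin 3 ≃ Fin 6 := finSumFinEquiv
    refine ⟨e, fun i => ?_⟩
    rw [← ZMod.intCast_zmod_eq_zero_iff_dvd]
    push_cast
    have h1 := hu (e (Sum.inl i))
    have h2 := hu (e (Sum.inr i))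
    generalize ((c (e (Sum.inl i)) : ℤ) : ZMod n) = a at *
    generalize ((c (e (Sum.inr i)) : ℤ) : ZMod n) = b at *
    interval_cases n
    · exact Subsingleton.elim _ _
    · revert a b; decide
  push Not at hn2
  have hne (i : Fin 6) : ((c i : ℤ) : ZMod n) ≠ -(c i : ℤ) := by
    intro h1
    have h2 : (2 : ZMod n) * (c i : ℤ) = 0 := by
      linear_combination h1
    rw [(hu i).mul_left_eq_zero] at h2
    have h3 : ((2 : ℕ) : ZMod n) = 0 := by exact_mod_cast h2
    rw [ZMod.natCast_eq_zero_iff] at h3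
    exact absurd (Nat.le_of_dvd two_pos h3) (by omega)
  have hodd (χ : DirichletCharacter ℂ n) (hχ : χ.Odd) : ∑ i, χ (c i) = 0 :=
    hχ.sum_eq_zero_of_sum_fract c hc fun k hk => by
      rw [Finset.sum_sub_distrib, h k hk]
      norm_num
  obtain ⟨σ, hσ, -, hσ3⟩ := exists_pairing_of_card_filter_eq (fun i => ((c i : ℤ) : ZMod n)) hne 3
    Finset.univ (by simp) (fun a => by
      by_cases ha : IsUnit a
      · exact ZMod.card_filter_eq_card_filter_neg _ hodd ha
      · rw [Finset.filter_false_of_mem, Finset.filter_false_of_mem]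
        · intro i _ hi
          apply ha
          rw [← neg_neg a, ← hi]
          exact (hu i).neg
        · intro i _ hi
          exact ha (hi ▸ hu i))
  refine ⟨Equiv.ofBijective σ ((Fintype.bijective_iff_injective_and_card σ).mpr ⟨hσ, by simp⟩),
    fun i => ?_⟩
  rw [← ZMod.intCast_zmod_eq_zero_iff_dvd]
  push_cast
  have := hσ3 i
  simp only [Equiv.ofBijective_apply]
  rw [this]
  ring

/-! ### The group of coefficient vectors and balanced simplices -/

namespace LatticePolytope

/-- The integers as a subring of `ℝ`. -/
abbrev ints : Subring ℝ := (Int.castRingHom ℝ).range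

theorem mem_ints_iff {x : ℝ} : x ∈ ints ↔ ∃ k : ℤ, (k : ℝ) = x := by
  simp [ints, RingHom.mem_range]

theorem mem_lattice_iff {ι : Type*} {x : ι → ℝ} : x ∈ lattice ι ↔ ∀ i, x i ∈ ints := by
  simp only [mem_ints_iff, lattice, Set.mem_range]
  constructor
  · rintro ⟨y, rfl⟩ i
    exact ⟨y i, rfl⟩
  · intro h
    choose y hy using h
    exact ⟨y, funext hy⟩

theorem eq_zero_of_mem_ints {x : ℝ} (hx : x ∈ ints) (h0 : 0 ≤ x) (h1 : x < 1) : x = 0 := by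
  obtain ⟨k, rfl⟩ := mem_ints_iff.mp hx
  have h2 : 0 ≤ k := by exact_mod_cast h0
  have h3 : k < 1 := by exact_mod_cast h1
  have : k = 0 := by omega
  simp [this]

theorem fract_eq_zero_iff_mem_ints {x : ℝ} : Int.fract x = 0 ↔ x ∈ ints := by
  rw [Int.fract_eq_zero_iff, mem_ints_iff, Set.mem_range]

/-- The vectors of coefficients with integral sum whose linear combination of the points `w i` is a
lattice point. -/
def baryLattice {ι κ : Type*} [Fintype κ] (w : κ → ι → ℤ) : AddSubgroup (κ → ℝ) where
  carrier := {x | ∑ i, x i ∈ ints ∧ ∀ j, ∑ i, x i * w i j ∈ ints}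
  add_mem' := by
    rintro x y ⟨hx, hx'⟩ ⟨hy, hy'⟩
    refine ⟨?_, fun j => ?_⟩
    · simpa [Finset.sum_add_distrib] using add_mem hx hy
    · simpa [Finset.sum_add_distrib, add_mul] using add_mem (hx' j) (hy' j)
  zero_mem' := by simp
  neg_mem' := by
    rintro x ⟨hx, hx'⟩
    refine ⟨?_, fun j => ?_⟩
    · simpa using neg_mem hx
    · simpa using neg_mem (hx' j)

section

variable {ι κ : Type*} [Fintype κ] {w : κ → ι → ℤ}

theorem mem_baryLattice_iff {x : κ → ℝ} :
    x ∈ baryLattice w ↔ ∑ i, x i ∈ ints ∧ ∀ j, ∑ i, x i * w i j ∈ ints := Iff.rfl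

theorem sum_smul_toReal_apply (x : κ → ℝ) (w : κ → ι → ℤ) (j : ι) :
    (∑ i, x i • toReal (w i)) j = ∑ i, x i * w i j := by
  simp [toReal]

theorem mem_baryLattice_iff_lattice {x : κ → ℝ} :
    x ∈ baryLattice w ↔ ∑ i, x i ∈ ints ∧ ∑ i, x i • toReal (w i) ∈ lattice ι := by
  simp only [mem_baryLattice_iff, mem_lattice_iff, sum_smul_toReal_apply]

theorem mem_baryLattice_of_mem_ints {x : κ → ℝ} (hx : ∀ i, x i ∈ ints) : x ∈ baryLattice w :=
  ⟨sum_mem fun i _ => hx i, fun _ => sum_mem fun i _ => mul_mem (hx i) (intCast_mem _ _)⟩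

theorem fract_mem_baryLattice {x : κ → ℝ} (hx : x ∈ baryLattice w) :
    (fun i => Int.fract (x i)) ∈ baryLattice w := by
  have : (fun i => Int.fract (x i)) = x - fun i => (⌊x i⌋ : ℝ) := by
    funext i
    exact (Int.self_sub_floor (x i)).symm
  rw [this]
  exact sub_mem hx (mem_baryLattice_of_mem_ints fun i => intCast_mem _ _)

theorem comp_equiv_mem_baryLattice {κ' : Type*} [Fintype κ'] (e : κ' ≃ κ) {x : κ → ℝ} :
    x ∘ e ∈ baryLattice (w ∘ e) ↔ x ∈ baryLattice w := by
  simp only [mem_baryLattice_iff, Function.comp_apply]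
  rw [Equiv.sum_comp e x]
  exact and_congr_right' (forall_congr' fun j => by rw [Equiv.sum_comp e fun i => x i * (w i j : ℝ)])

/-- Barycentric coordinates are unique. -/
theorem eq_of_sum_smul_eq (hw : AffineIndependent ℝ fun i => toReal (w i)) {x y : κ → ℝ}
    (hs : ∑ i, x i = ∑ i, y i)
    (h : ∑ i, x i • toReal (w i) = ∑ i, y i • toReal (w i)) : x = y := by
  have := (affineIndependent_iff (k := ℝ) (p := fun i => toReal (w i))).mp hw Finset.univ (x - y)
    (by simp [Finset.sum_sub_distrib, hs]) (by simp [sub_smul, Finset.sum_sub_distrib, h])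
  funext i
  exact sub_eq_zero.mp (this i (Finset.mem_univ i))

theorem mem_conv_iff {y : ι → ℝ} :
    y ∈ conv w ↔ ∃ x : κ → ℝ, (∀ i, 0 ≤ x i) ∧ ∑ i, x i = 1 ∧ ∑ i, x i • toReal (w i) = y := by
  rw [conv, convexHull_range_eq_exists_affineCombination]
  simp only [Set.mem_ofPred_eq]
  constructor
  · rintro ⟨s, x, h0, h1, rfl⟩
    classical
    refine ⟨fun i => if i ∈ s then x i else 0, fun i => ?_, ?_, ?_⟩
    · dsimp only
      split_ifs with h
      · exact h0 i h
      · exact le_rfl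
    · simpa using h1
    · rw [Finset.affineCombination_eq_linear_combination _ _ _ h1]
      simp [ite_smul]
  · rintro ⟨x, h0, h1, rfl⟩
    exact ⟨Finset.univ, x, fun i _ => h0 i, h1,
      Finset.affineCombination_eq_linear_combination _ _ _ h1⟩

theorem mem_smul_conv_iff [Nonempty κ] {k : ℕ} {y : ι → ℝ} :
    y ∈ (k : ℝ) • conv w ↔
      ∃ x : κ → ℝ, (∀ i, 0 ≤ x i) ∧ ∑ i, x i = k ∧ ∑ i, x i • toReal (w i) = y := by
  classical
  simp only [Set.mem_smul_set, mem_conv_iff]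
  constructor
  · rintro ⟨z, ⟨x, h0, h1, rfl⟩, rfl⟩
    refine ⟨fun i => k * x i, fun i => mul_nonneg (Nat.cast_nonneg k) (h0 i), ?_, ?_⟩
    · rw [← Finset.mul_sum, h1, mul_one]
    · rw [Finset.smul_sum]
      simp_rw [mul_smul]
  · rintro ⟨x, h0, h1, rfl⟩
    rcases Nat.eq_zero_or_pos k with rfl | hk
    · have hx : ∀ i, x i = 0 := by
        have := (Finset.sum_eq_zero_iff_of_nonneg fun i _ => h0 i).mp (by simpa using h1)
        exact fun i => this i (Finset.mem_univ i)
      refine ⟨_, ⟨Pi.single (Classical.arbitrary κ) 1, fun i => ?_, by simp, rfl⟩, by simp [hx]⟩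
      by_cases h : i = Classical.arbitrary κ
      · subst h; simp
      · simp [h]
    · have hk' : (k : ℝ) ≠ 0 := by exact_mod_cast hk.ne'
      refine ⟨_, ⟨fun i => x i / k, fun i => div_nonneg (h0 i) (Nat.cast_nonneg k), ?_, rfl⟩, ?_⟩
      · rw [← Finset.sum_div, h1, div_self hk']
      · rw [Finset.smul_sum]
        refine Finset.sum_congr rfl fun i _ => ?_
        rw [smul_smul, mul_div_cancel₀ _ hk']

end

/-- The condition that all nontrivial coefficient vectors in the half open unit cube have
coordinate sum three. -/
def Balanced (v : Fin 6 → Fin 5 → ℤ) : Prop :=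
  ∀ x ∈ baryLattice v, (∀ i, 0 ≤ x i) → (∀ i, x i < 1) → x ≠ 0 → ∑ i, x i = 3

/-- A coordinate contributes 0 if it is an integer and 1 otherwise. -/
theorem sum_fract_add_sum_fract_neg_le {κ : Type*} (s : Finset κ) (x : κ → ℝ) :
    ∑ i ∈ s, Int.fract (x i) + ∑ i ∈ s, Int.fract (-x i) ≤ s.card := by
  rw [← Finset.sum_add_distrib, ← nsmul_one, ← Finset.sum_const]
  refine Finset.sum_le_sum fun i _ => ?_
  by_cases h : Int.fract (x i) = 0
  · rw [h, Int.fract_neg_eq_zero.mpr h]; norm_num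
  · rw [Int.fract_neg h]; linarith

variable {v : Fin 6 → Fin 5 → ℤ}

theorem Balanced.sum_fract (h : Balanced v) {x : Fin 6 → ℝ} (hx : x ∈ baryLattice v) {j : Fin 6}
    (hj : x j ∉ ints) : ∑ i, Int.fract (x i) = 3 := by
  refine h _ (fract_mem_baryLattice hx) (fun i => Int.fract_nonneg _) (fun i => Int.fract_lt_one _)
    fun h0 => hj ?_
  rw [← fract_eq_zero_iff_mem_ints]
  exact congrFun h0 j

/-- If some coordinate were not integral, the fractional parts of x and of -x would each sum to 3.
The integral coordinate j contributes nothing, so the other five would have to contribute 6. -/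
theorem Balanced.mem_ints (h : Balanced v) {x : Fin 6 → ℝ} (hx : x ∈ baryLattice v) {j : Fin 6}
    (hj : x j ∈ ints) (i : Fin 6) : x i ∈ ints := by
  by_contra hi
  have h1 := h.sum_fract hx hi
  have h2 := h.sum_fract (neg_mem hx) (j := i) (by simpa using hi)
  have h3 := sum_fract_add_sum_fract_neg_le (Finset.univ.erase j) x
  have h4 : Int.fract (x j) = 0 := fract_eq_zero_iff_mem_ints.mpr hj
  rw [← Finset.add_sum_erase _ _ (Finset.mem_univ j), h4] at h1
  simp only [Pi.neg_apply] at h2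
  rw [← Finset.add_sum_erase _ _ (Finset.mem_univ j), Int.fract_neg_eq_zero.mpr h4] at h2
  rw [Finset.card_erase_of_mem (Finset.mem_univ j), Finset.card_univ, Fintype.card_fin] at h3
  push_cast at h3
  linarith

/-- The fractional part of -x is again a nonzero box point, and the two sums add up to at most 6. -/
theorem balanced_of_three_le
    (h : ∀ x ∈ baryLattice v, (∀ i, 0 ≤ x i) → (∀ i, x i < 1) → x ≠ 0 → 3 ≤ ∑ i, x i) :
    Balanced v := by
  intro x hx h0 h1 hne
  have hf : ∀ i, Int.fract (x i) = x i := fun i => Int.fract_eq_self.mpr ⟨h0 i, h1 i⟩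
  have h2 := h x hx h0 h1 hne
  have h3 := h _ (fract_mem_baryLattice (neg_mem hx)) (fun i => Int.fract_nonneg _)
    (fun i => Int.fract_lt_one _) (by
      intro h4
      apply hne
      funext i
      have := congrFun h4 i
      simp only [Pi.neg_apply, Pi.zero_apply, Int.fract_neg_eq_zero] at this
      rw [← hf i, this]
      rfl)
  have h5 := sum_fract_add_sum_fract_neg_le Finset.univ x
  simp only [hf, Finset.card_univ, Fintype.card_fin, Pi.neg_apply] at h3 h5
  norm_num at h5
  linarith

/-- The first condition of the theorem says that there are no nontrivial coefficient vectors with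
coordinate sum one or two. -/
theorem balanced_of_emptySimplex (hv : AffineIndependent ℝ fun i => toReal (v i))
    (h1 : EmptySimplex v) (h2 : DoubleOnlyVerticesAndMidpoints v) : Balanced v := by
  refine balanced_of_three_le fun x hx hx0 hx1 hne => ?_
  by_contra! hlt
  have hxL := mem_baryLattice_iff_lattice.mp hx
  obtain ⟨k, hk⟩ := mem_ints_iff.mp hxL.1
  have hpos : 0 < ∑ i, x i := by
    refine (Finset.sum_nonneg fun i _ => hx0 i).lt_of_ne fun h => hne ?_
    have := (Finset.sum_eq_zero_iff_of_nonneg fun i _ => hx0 i).mp h.symm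
    funext i
    exact this i (Finset.mem_univ i)
  rw [← hk] at hpos hlt
  have hk0 : 0 < k := by exact_mod_cast hpos
  have hk3 : k < 3 := by exact_mod_cast hlt
  -- Splitting off a vertex would force x j = z j + 1 ≥ 1 by uniqueness of coefficients. Vertices of
  -- Δ, and sums of two vertices, all split in this way.
  have hnot (j : Fin 6) (z : Fin 6 → ℝ) (hz : ∀ i, 0 ≤ z i) (hs : ∑ i, z i + 1 = k) :
      ∑ i, x i • toReal (v i) ≠ ∑ i, z i • toReal (v i) + toReal (v j) := by
    intro he
    have := eq_of_sum_smul_eq hv (x := x) (y := z + Pi.single j 1)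
      (by simp [Finset.sum_add_distrib, hs, hk])
      (by rw [he]; simp [add_smul, Finset.sum_add_distrib, Pi.single_apply, ite_smul])
    have h3 := congrFun this j
    have := hx1 j
    have := hz j
    simp at h3
    linarith
  interval_cases k
  · have hmem : ∑ i, x i • toReal (v i) ∈ conv v ∩ lattice (Fin 5) :=
      ⟨mem_conv_iff.mpr ⟨x, hx0, by rw [← hk]; simp, rfl⟩, hxL.2⟩
    rw [h1] at hmem
    obtain ⟨j, hj⟩ := hmem
    exact hnot j 0 (by simp) (by simp) (by simpa using hj.symm)
  · have hmem : ∑ i, x i • toReal (v i) ∈ ((2 : ℝ) • conv v) ∩ lattice (Fin 5) := by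
      refine ⟨?_, hxL.2⟩
      have := mem_smul_conv_iff (k := 2) (w := v) (y := ∑ i, x i • toReal (v i))
      rw [Nat.cast_ofNat] at this
      exact this.mpr ⟨x, hx0, by rw [← hk]; simp, rfl⟩
    obtain ⟨i, j, hij⟩ : ∃ i j, ∑ i, x i • toReal (v i) = toReal (v i) + toReal (v j) := by
      rcases h2 _ hmem with ⟨i, hi⟩ | ⟨i, j, -, hij⟩
      · exact ⟨i, i, by rw [hi, two_smul]⟩
      · refine ⟨i, j, hij.trans ?_⟩
        rw [midpoint_eq_smul_add, ← smul_add, smul_smul]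
        norm_num
    refine hnot j (Pi.single i 1) (fun l => ?_) (by simp; norm_num) ?_
    · by_cases h : l = i
      · subst h; simp
      · simp [h]
    · rw [hij]; simp [Pi.single_apply, ite_smul]

end LatticePolytope

/-! ### Counting lattice points of multiples: from balanced to h* -/

namespace LatticePolytope

variable {v : Fin 6 → Fin 5 → ℤ}

/-- The coefficient vectors in `baryLattice v` have a common denominator. -/
theorem exists_denominator (hv : AffineIndependent ℝ fun i => toReal (v i)) :
    ∃ N : ℕ, 0 < N ∧ ∀ x ∈ baryLattice v, ∀ i, (N : ℝ) * x i ∈ ints := by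
  -- Homogenised vertices: the column of ones records the coordinate sum, and by the adjugate the
  -- nonzero determinant clears all denominators.
  set M : Matrix (Fin 6) (Fin 6) ℤ := Matrix.of fun i => Fin.cons 1 (v i) with hM
  set MR : Matrix (Fin 6) (Fin 6) ℝ := M.map (Int.cast : ℤ → ℝ) with hMR
  have h0 (x : Fin 6 → ℝ) : Matrix.vecMul x MR 0 = ∑ i, x i := by
    simp [Matrix.vecMul, dotProduct, hMR, hM]
  have h1 (x : Fin 6 → ℝ) (j : Fin 5) : Matrix.vecMul x MR j.succ = ∑ i, x i * v i j := by
    simp [Matrix.vecMul, dotProduct, hMR, hM]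
  have hdetR : MR.det = (M.det : ℝ) := by
    rw [hMR]
    exact (Int.cast_det (R := ℝ) M).symm
  have hdet : MR.det ≠ 0 := by
    intro hd
    obtain ⟨x, hx, hx0⟩ := Matrix.exists_vecMul_eq_zero_iff.mpr hd
    apply hx
    refine eq_of_sum_smul_eq hv ?_ ?_
    · rw [← h0, hx0]; simp
    · funext j
      rw [sum_smul_toReal_apply, ← h1, hx0]
      simp
  refine ⟨M.det.natAbs, ?_, fun x hx i => ?_⟩
  · rw [Int.natAbs_pos]
    intro h
    rw [hdetR, h] at hdet
    simp at hdet
  · have hmem : ∀ j, Matrix.vecMul x MR j ∈ ints := by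
      refine Fin.cases ?_ fun j => ?_
      · rw [h0]; exact hx.1
      · rw [h1]; exact hx.2 j
    have hadj : MR.adjugate = M.adjugate.map (Int.cast : ℤ → ℝ) :=
      ((Int.castRingHom ℝ).map_adjugate M).symm
    have h2 : (M.det : ℝ) * x i ∈ ints := by
      have h3 : Matrix.vecMul (Matrix.vecMul x MR) MR.adjugate i = MR.det * x i := by
        rw [Matrix.vecMul_vecMul, Matrix.mul_adjugate]
        simp [Matrix.vecMul_smul]
      rw [← hdetR, ← h3, hadj]
      change ∑ j, Matrix.vecMul x MR j * ((M.adjugate j i : ℤ) : ℝ) ∈ ints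
      exact sum_mem fun j _ => mul_mem (hmem j) (intCast_mem _ _)
    have habs : ((M.det.natAbs : ℕ) : ℝ) = |(M.det : ℝ)| := by simp [Nat.cast_natAbs]
    rw [habs]
    rcases abs_choice (M.det : ℝ) with h | h <;> rw [h]
    · exact h2
    · rw [neg_mul]
      exact neg_mem h2

/-- The coefficient vectors in the half open unit cube. -/
def boxPoints (v : Fin 6 → Fin 5 → ℤ) : Set (Fin 6 → ℝ) :=
  {x | x ∈ baryLattice v ∧ ∀ i, 0 ≤ x i ∧ x i < 1}

theorem finite_boxPoints (hv : AffineIndependent ℝ fun i => toReal (v i)) :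
    (boxPoints v).Finite := by
  obtain ⟨N, hN, h⟩ := exists_denominator hv
  have hN' : (0 : ℝ) < N := by exact_mod_cast hN
  have hfin : ((fun m : ℕ => (m : ℝ) / N) '' (Finset.range N : Set ℕ)).Finite :=
    (Finset.finite_toSet _).image _
  refine (Set.Finite.pi' (fun _ : Fin 6 => hfin)).subset ?_
  rintro x ⟨hx, hx1⟩ i
  obtain ⟨k, hk⟩ := mem_ints_iff.mp (h x hx i)
  have h0 : 0 ≤ k := by
    have : (0 : ℝ) ≤ k := by rw [hk]; exact mul_nonneg hN'.le (hx1 i).1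
    exact_mod_cast this
  have h1 : k < N := by
    have : (k : ℝ) < N := by rw [hk]; nlinarith [(hx1 i).2]
    exact_mod_cast this
  refine ⟨k.toNat, by simp; omega, ?_⟩
  have : ((k.toNat : ℕ) : ℝ) = k := by
    exact_mod_cast Int.toNat_of_nonneg h0
  simp only
  rw [this, hk]
  field_simp

theorem card_finsuppAntidiag_fin_six (k : ℕ) :
    ((Finset.univ : Finset (Fin 6)).finsuppAntidiag k).card = (5 + k).choose 5 := by
  rw [Finset.card_finsuppAntidiag_nat_eq_choose, Finset.card_univ, Fintype.card_fin,
    show 6 + k - 1 = 5 + k by omega]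
  exact Nat.choose_symm_of_eq_add (by omega)

/-- The number of lattice points of the multiples of a simplex all of whose nontrivial coefficient
vectors in the unit cube have coordinate sum three. -/
theorem Balanced.exists_ncard_eq (h : Balanced v)
    (hv : AffineIndependent ℝ fun i => toReal (v i)) :
    ∃ r : ℕ, ∀ k : ℕ, (((k : ℝ) • conv v) ∩ lattice (Fin 5)).ncard =
      (5 + k).choose 5 + r * if 3 ≤ k then (5 + (k - 3)).choose 5 else 0 := by
  classical
  set F := (finite_boxPoints hv).toFinset with hF
  have hFmem (x) : x ∈ F ↔ x ∈ baryLattice v ∧ ∀ i, 0 ≤ x i ∧ x i < 1 := by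
    rw [hF, Set.Finite.mem_toFinset]
    rfl
  refine ⟨(F.erase 0).card, fun k => ?_⟩
  set A := (Finset.univ : Finset (Fin 6)).finsuppAntidiag k with hA
  set B := if 3 ≤ k then (Finset.univ : Finset (Fin 6)).finsuppAntidiag (k - 3) else ∅ with hB
  have hBmem (m) : m ∈ B ↔ ∑ i, m i + 3 = k := by
    rw [hB]
    split_ifs with hk
    · simp only [Finset.mem_finsuppAntidiag, Finset.subset_univ, and_true]
      change Finset.univ.sum m = k - 3 ↔ Finset.univ.sum m + 3 = k
      omega
    · simp only [Finset.notMem_empty, false_iff]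
      omega
  have hAmem (m) : m ∈ A ↔ ∑ i, m i = k := by
    simp [hA, Finset.mem_finsuppAntidiag]
  -- Pairs of fractional part and floor: total k leaves k for the floors if the fractional part is
  -- 0, and k - 3 otherwise. `B` is empty for k < 3 because natural subtraction would truncate.
  set T := (({0} : Finset (Fin 6 → ℝ)) ×ˢ A) ∪ ((F.erase 0) ×ˢ B) with hT
  have hTcard : T.card =
      (5 + k).choose 5 + (F.erase 0).card * if 3 ≤ k then (5 + (k - 3)).choose 5 else 0 := by
    rw [hT, Finset.card_union_of_disjoint, Finset.card_product, Finset.card_product,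
      Finset.card_singleton, one_mul, hA, card_finsuppAntidiag_fin_six, hB]
    · split_ifs
      · rw [card_finsuppAntidiag_fin_six]
      · simp
    · rw [Finset.disjoint_left]
      rintro ⟨f, m⟩ h1 h2
      simp only [Finset.mem_product, Finset.mem_singleton, Finset.mem_erase] at h1 h2
      exact h2.1.1 h1.1
  have hTmem (f : Fin 6 → ℝ) (m : Fin 6 →₀ ℕ) :
      (f, m) ∈ T ↔ f ∈ F ∧ ∑ i, (f i + m i) = k := by
    simp only [hT, Finset.mem_union, Finset.mem_product, Finset.mem_singleton, Finset.mem_erase,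
      hAmem, hBmem, Finset.sum_add_distrib]
    rcases eq_or_ne f 0 with rfl | hf
    · have h0 : (0 : Fin 6 → ℝ) ∈ F := by
        rw [hFmem]
        exact ⟨zero_mem _, fun i => by simp⟩
      simp only [true_and, ne_eq, not_true_eq_false, false_and, or_false, h0, Pi.zero_apply,
        Finset.sum_const_zero, zero_add]
      norm_cast
    · simp only [hf, false_and, ne_eq, not_false_eq_true, true_and, false_or]
      refine and_congr_right fun hfF => ?_
      rw [hFmem] at hfF
      rw [h f hfF.1 (fun i => (hfF.2 i).1) (fun i => (hfF.2 i).2) hf]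
      rw [add_comm]
      norm_cast
  set Φ : (Fin 6 → ℝ) × (Fin 6 →₀ ℕ) → Fin 5 → ℝ :=
    fun fm => ∑ i, (fm.1 i + fm.2 i) • toReal (v i) with hΦ
  have hinj : Set.InjOn Φ T := by
    rintro ⟨f, m⟩ h1 ⟨f', m'⟩ h2 he
    rw [Finset.mem_coe, hTmem] at h1 h2
    have := eq_of_sum_smul_eq hv (h1.2.trans h2.2.symm) he
    have hf : f = f' := by
      funext i
      have h3 := congrArg Int.fract (congrFun this i)
      rw [Int.fract_add_natCast, Int.fract_add_natCast,
        Int.fract_eq_self.mpr (((hFmem f).mp h1.1).2 i),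
        Int.fract_eq_self.mpr (((hFmem f').mp h2.1).2 i)] at h3
      exact h3
    subst hf
    have hm : m = m' := by
      ext i
      have h3 := congrFun this i
      simp only [add_right_inj] at h3
      exact_mod_cast h3
    rw [hm]
  have himg : ((k : ℝ) • conv v) ∩ lattice (Fin 5) = Φ '' T := by
    ext y
    rw [Set.mem_inter_iff, mem_smul_conv_iff]
    constructor
    · rintro ⟨⟨x, hx0, hxs, rfl⟩, hy⟩
      have hxL : x ∈ baryLattice v :=
        mem_baryLattice_iff_lattice.mpr ⟨by rw [hxs]; exact natCast_mem _ _, hy⟩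
      refine ⟨(fun i => Int.fract (x i), Finsupp.equivFunOnFinite.symm fun i => ⌊x i⌋₊), ?_, ?_⟩
      · rw [Finset.mem_coe, hTmem, hFmem]
        refine ⟨⟨fract_mem_baryLattice hxL,
          fun i => ⟨Int.fract_nonneg _, Int.fract_lt_one _⟩⟩, ?_⟩
        rw [← hxs]
        refine Finset.sum_congr rfl fun i _ => ?_
        simp only [Finsupp.equivFunOnFinite_symm_apply_apply]
        rw [natCast_floor_eq_intCast_floor (hx0 i), Int.fract_add_floor]
      · rw [hΦ]
        refine Finset.sum_congr rfl fun i _ => ?_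
        simp only [Finsupp.equivFunOnFinite_symm_apply_apply]
        rw [natCast_floor_eq_intCast_floor (hx0 i), Int.fract_add_floor]
    · rintro ⟨⟨f, m⟩, hfm, rfl⟩
      rw [Finset.mem_coe, hTmem, hFmem] at hfm
      refine ⟨⟨fun i => f i + m i, fun i => add_nonneg (hfm.1.2 i).1 (Nat.cast_nonneg _), hfm.2,
        rfl⟩, ?_⟩
      refine (mem_baryLattice_iff_lattice (w := v) (x := fun i => f i + m i)).mp ?_ |>.2
      exact add_mem hfm.1.1 (mem_baryLattice_of_mem_ints (x := fun i => (m i : ℝ))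
        fun i => natCast_mem _ _)
  rw [himg, hinj.ncard_image, Set.ncard_coe_finset, hTcard]

/-- The coefficients of (1 - t)⁻⁶ are the binomials (5 + k choose 5), so the counts assemble to (1 +
r t³)(1 - t)⁻⁶, where r counts the nonzero box points. -/
theorem Balanced.exists_hStar_eq (h : Balanced v)
    (hv : AffineIndependent ℝ fun i => toReal (v i)) :
    ∃ n : ℤ, 1 ≤ n ∧ hStar (conv v) = 1 + PowerSeries.C (n - 1) * PowerSeries.X ^ 3 := by
  obtain ⟨r, hr⟩ := h.exists_ncard_eq hv
  refine ⟨r + 1, by omega, ?_⟩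
  have hE : ehrhartSeries (conv v) = (1 + PowerSeries.C (r : ℤ) * PowerSeries.X ^ 3) *
      (PowerSeries.invOneSubPow ℤ 6).val := by
    ext k
    rw [ehrhartSeries, PowerSeries.coeff_mk, PowerSeries.invOneSubPow_val_succ_eq_mk_add_choose,
      add_mul, one_mul, mul_assoc, map_add, PowerSeries.coeff_mk, PowerSeries.coeff_C_mul,
      PowerSeries.coeff_X_pow_mul']
    rcases Nat.eq_zero_or_pos k with rfl | hk
    · simp
    · rw [if_neg hk.ne', hr]
      split_ifs <;> simp
  rw [hStar, hE, mul_left_comm, ← PowerSeries.invOneSubPow_inv_eq_one_sub_pow, Units.inv_eq_val_inv,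
    Units.inv_mul, mul_one, add_sub_cancel_right]

end LatticePolytope

/-! ### From h* back to the lattice points of Δ and 2Δ -/

namespace LatticePolytope

variable {v : Fin 6 → Fin 5 → ℤ}

/-- The t³ term does not affect degrees 1 and 2, so the counts are those of a basic simplex. -/
theorem ncard_eq_of_hStar_eq {n : ℤ}
    (h : hStar (conv v) = 1 + PowerSeries.C (n - 1) * PowerSeries.X ^ 3) :
    (conv v ∩ lattice (Fin 5)).ncard = 6 ∧ (((2 : ℝ) • conv v) ∩ lattice (Fin 5)).ncard = 21 := by
  have hE : ehrhartSeries (conv v) = (1 + PowerSeries.C (n - 1) * PowerSeries.X ^ 3) *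
      (PowerSeries.invOneSubPow ℤ 6).val := by
    rw [← h, hStar, ← PowerSeries.invOneSubPow_inv_eq_one_sub_pow, Units.inv_eq_val_inv,
      mul_right_comm, Units.inv_mul, one_mul]
  have hk (k : ℕ) (hk0 : k ≠ 0) (hk3 : k < 3) :
      ((((k : ℝ) • conv v) ∩ lattice (Fin 5)).ncard : ℤ) = (5 + k).choose 5 := by
    have := congrArg (PowerSeries.coeff k) hE
    rw [ehrhartSeries, PowerSeries.coeff_mk, PowerSeries.invOneSubPow_val_succ_eq_mk_add_choose,
      add_mul, one_mul, mul_assoc, map_add, PowerSeries.coeff_mk, PowerSeries.coeff_C_mul,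
      PowerSeries.coeff_X_pow_mul', if_neg hk0, if_neg (by omega), mul_zero, add_zero] at this
    exact this
  refine ⟨?_, ?_⟩
  · have := hk 1 one_ne_zero (by norm_num)
    rw [Nat.cast_one, one_smul] at this
    exact_mod_cast this
  · have := hk 2 two_ne_zero (by norm_num)
    have h21 : Nat.choose (5 + 2) 5 = 21 := rfl
    rw [Nat.cast_ofNat, h21] at this
    exact_mod_cast this

theorem emptySimplex_of_ncard_eq (hv : AffineIndependent ℝ fun i => toReal (v i))
    (h : (conv v ∩ lattice (Fin 5)).ncard = 6) : EmptySimplex v := by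
  have hsub : Set.range (fun i => toReal (v i)) ⊆ conv v ∩ lattice (Fin 5) := by
    rintro _ ⟨i, rfl⟩
    exact ⟨subset_convexHull ℝ _ ⟨i, rfl⟩, ⟨v i, rfl⟩⟩
  refine (Set.eq_of_subset_of_ncard_le hsub ?_ (Set.finite_of_ncard_ne_zero (by omega))).symm
  rw [h, ← Set.image_univ, Set.ncard_image_of_injective _ hv.injective, Set.ncard_univ]
  simp

/-- The sums of two vertices, indexed by unordered pairs with repetition, are 21 distinct lattice
points of 2Δ, so they exhaust it. -/
theorem doubleOnlyVerticesAndMidpoints_of_ncard_eq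
    (hv : AffineIndependent ℝ fun i => toReal (v i))
    (h : (((2 : ℝ) • conv v) ∩ lattice (Fin 5)).ncard = 21) :
    DoubleOnlyVerticesAndMidpoints v := by
  set f : Sym2 (Fin 6) → Fin 5 → ℝ :=
    Sym2.lift ⟨fun i j => toReal (v i) + toReal (v j), fun i j => add_comm _ _⟩ with hf
  have hfs (i j : Fin 6) : f s(i, j) =
      ∑ l, (Pi.single i 1 + Pi.single j 1 : Fin 6 → ℝ) l • toReal (v l) := by
    simp [hf, add_smul, Finset.sum_add_distrib, Pi.single_apply, ite_smul]
  have hinj : Function.Injective f := by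
    intro a b
    induction a with | _ i j
    induction b with | _ k l
    intro he
    rw [hfs, hfs] at he
    have := eq_of_sum_smul_eq hv (by simp [Finset.sum_add_distrib]) he
    have h1 (m : Fin 6) : ((if m = i then 1 else 0) + (if m = j then 1 else 0) : ℕ) =
        (if m = k then 1 else 0) + (if m = l then 1 else 0) := by
      have h2 := congrFun this m
      simp only [Pi.add_apply, Pi.single_apply] at h2
      exact_mod_cast h2
    have hi := h1 i
    have hj := h1 j
    have hk := h1 k
    simp only [if_true] at hi hj hk
    rw [Sym2.eq_iff]
    grind
  have hsub : Set.range f ⊆ ((2 : ℝ) • conv v) ∩ lattice (Fin 5) := by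
    rintro _ ⟨a, rfl⟩
    induction a with | _ i j
    refine ⟨?_, ⟨v i + v j, by funext m; simp [hf, toReal]⟩⟩
    refine ⟨midpoint ℝ (toReal (v i)) (toReal (v j)), ?_, ?_⟩
    · exact (convex_convexHull ℝ _).midpoint_mem (subset_convexHull ℝ _ ⟨i, rfl⟩)
        (subset_convexHull ℝ _ ⟨j, rfl⟩)
    · simp only [midpoint_eq_smul_add, smul_smul]
      simp [hf]
  have heq := Set.eq_of_subset_of_ncard_le hsub (by
    rw [h, ← Set.image_univ, Set.ncard_image_of_injective _ hinj, Set.ncard_univ,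
      Nat.card_eq_fintype_card, Sym2.card, Fintype.card_fin]
    decide) (Set.finite_of_ncard_ne_zero (by omega))
  intro x hx
  rw [← heq] at hx
  obtain ⟨a, rfl⟩ := hx
  induction a with | _ i j
  by_cases hij : i = j
  · left
    subst hij
    exact ⟨i, by simp [hf, two_smul]⟩
  · right
    refine ⟨i, j, hij, ?_⟩
    rw [midpoint_eq_smul_add, ← smul_add, smul_smul]
    simp [hf]

end LatticePolytope

/-! ### Basic facets and integrality of coefficients -/

namespace LatticePolytope

/-- A linearly independent family of integral vectors which spans a saturated sublattice is part of
a lattice basis. -/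
theorem exists_basis_of_saturated {d k : ℕ} (u : Fin k → Fin d → ℤ) (hu : LinearIndependent ℤ u)
    (hsat : ∀ (m : ℤ) (y : Fin d → ℤ), m ≠ 0 → m • y ∈ Submodule.span ℤ (Set.range u) →
      y ∈ Submodule.span ℤ (Set.range u)) :
    ∃ (b : Module.Basis (Fin d) ℤ (Fin d → ℤ)) (f : Fin k ↪ Fin d), ∀ i, u i = b (f i) := by
  set W := Submodule.span ℤ (Set.range u) with hW
  -- Saturation says that the quotient is torsion-free, hence free, so a basis of `W` extends by
  -- lifts of a basis of the quotient.
  have htf : Module.IsTorsionFree ℤ ((Fin d → ℤ) ⧸ W) := by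
    refine ⟨fun m hm => isSMulRegular_iff_right_eq_zero_of_smul.mpr fun q hq => ?_⟩
    obtain ⟨y, rfl⟩ := Submodule.Quotient.mk_surjective W q
    rw [← Submodule.Quotient.mk_smul, Submodule.Quotient.mk_eq_zero] at hq
    rw [Submodule.Quotient.mk_eq_zero]
    exact hsat m y hm.ne_zero hq
  have : Module.Free ℤ ((Fin d → ℤ) ⧸ W) := inferInstance
  let bQ := Module.Free.chooseBasis ℤ ((Fin d → ℤ) ⧸ W)
  let bW : Module.Basis (Fin k) ℤ W := Module.Basis.span hu
  let B := Module.Basis.sumQuot bW bQ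
  let e := B.indexEquiv (Pi.basisFun ℤ (Fin d))
  refine ⟨B.reindex e, Function.Embedding.inl.trans e.toEmbedding, fun i => ?_⟩
  simp only [Module.Basis.reindex_apply, Function.Embedding.trans_apply,
    Function.Embedding.inl_apply, Equiv.coe_toEmbedding, Equiv.symm_apply_apply]
  rw [Module.Basis.sumQuot_inl]
  exact (congrArg Subtype.val (Module.Basis.span_apply hu i)).symm

variable {d k : ℕ} {v : Fin (k + 2) → Fin d → ℤ}

/-- If the facet opposite to `v j` is basic, then it has no nontrivial coefficient vectors. -/
theorem BasicSimplex.mem_ints {j : Fin (k + 2)}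
    (h : BasicSimplex fun i : Fin (k + 1) => v (j.succAbove i)) {x : Fin (k + 2) → ℝ}
    (hx : x ∈ baryLattice v) (hj : x j = 0) (i : Fin (k + 2)) : x i ∈ ints := by
  obtain ⟨b, f, hb⟩ := h
  have hsum : x (j.succAbove (Fin.last k)) =
      ∑ i, x i - ∑ i : Fin k, x (j.succAbove i.castSucc) := by
    rw [Fin.sum_univ_succAbove _ j, hj, Fin.sum_univ_castSucc]
    ring
  have hmem (l : Fin d) : ∑ i : Fin k, x (j.succAbove i.castSucc) * (b (f i) l : ℝ) ∈ ints := by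
    have h1 := hx.2 l
    rw [Fin.sum_univ_succAbove _ j, hj, Fin.sum_univ_castSucc, zero_mul, zero_add, hsum] at h1
    have h2 : ∑ i : Fin k, x (j.succAbove i.castSucc) * (b (f i) l : ℝ) =
        (∑ i : Fin k, x (j.succAbove i.castSucc) * (v (j.succAbove i.castSucc) l : ℝ) +
          (∑ i, x i - ∑ i : Fin k, x (j.succAbove i.castSucc)) *
            (v (j.succAbove (Fin.last k)) l : ℝ)) -
        (∑ i, x i) * (v (j.succAbove (Fin.last k)) l : ℝ) := by
      simp_rw [← hb, Pi.sub_apply, Int.cast_sub, mul_sub, Finset.sum_sub_distrib, ← Finset.sum_mul]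
      ring
    rw [h2]
    exact sub_mem h1 (mul_mem hx.1 (intCast_mem _ _))
  -- The dual basis functional of `b (f i)` has integral entries and extracts this coefficient from
  -- the integral vector in `hmem`.
  have hcast (i : Fin k) : x (j.succAbove i.castSucc) ∈ ints := by
    have h3 (i' : Fin k) : ∑ l, b (f i') l * b.coord (f i) (Pi.single l 1) =
        if i' = i then 1 else 0 := by
      have h4 : b.coord (f i) (b (f i')) = ∑ l, b (f i') l * b.coord (f i) (Pi.single l 1) := by
        conv_lhs => rw [← (Pi.basisFun ℤ (Fin d)).sum_repr (b (f i'))]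
        simp only [map_sum, map_smul, Pi.basisFun_repr, Pi.basisFun_apply, smul_eq_mul]
      rw [← h4]
      simp [Finsupp.single_apply]
    have h5 : x (j.succAbove i.castSucc) = ∑ l, (∑ i' : Fin k, x (j.succAbove i'.castSucc) *
        (b (f i') l : ℝ)) * (b.coord (f i) (Pi.single l 1) : ℝ) := by
      simp_rw [Finset.sum_mul]
      rw [Finset.sum_comm]
      simp_rw [mul_assoc, ← Finset.mul_sum]
      have h6 (i' : Fin k) : ∑ l, (b (f i') l : ℝ) * (b.coord (f i) (Pi.single l 1) : ℝ) =
          if i' = i then 1 else 0 := by exact_mod_cast h3 i'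
      simp_rw [h6]
      simp
    rw [h5]
    exact sum_mem fun l _ => mul_mem (hmem l) (intCast_mem _ _)
  rcases Fin.eq_self_or_eq_succAbove j i with rfl | ⟨i, rfl⟩
  · rw [hj]; exact zero_mem _
  · refine Fin.lastCases ?_ (fun i => hcast i) i
    rw [hsum]
    exact sub_mem hx.1 (sum_mem fun i _ => hcast i)

/-- If a facet has no nontrivial coefficient vectors, then it is basic. -/
theorem basicSimplex_of_mem_ints (hv : AffineIndependent ℝ fun i => toReal (v i))
    (j : Fin (k + 2)) (h : ∀ x ∈ baryLattice v, x j = 0 → ∀ i, x i ∈ ints) :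
    BasicSimplex fun i : Fin (k + 1) => v (j.succAbove i) := by
  set u : Fin k → Fin d → ℤ :=
    fun i => v (j.succAbove i.castSucc) - v (j.succAbove (Fin.last k)) with hu
  -- Completes c to a coefficient vector with entry 0 at j and total 0, so that its combination of
  -- the vertices equals that of the edge vectors `u`.
  let X (c : Fin k → ℝ) : Fin (k + 2) → ℝ :=
    j.insertNth 0 (Fin.snoc (α := fun _ => ℝ) c (-∑ i, c i))
  have hXj (c) : X c j = 0 := by simp [X]
  have hXc (c) (i : Fin k) : X c (j.succAbove i.castSucc) = c i := by simp [X]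
  have hXl (c) : X c (j.succAbove (Fin.last k)) = -∑ i, c i := by simp [X]
  have hXs (c) : ∑ i, X c i = 0 := by
    rw [Fin.sum_univ_succAbove _ j, Fin.sum_univ_castSucc, hXj, hXl]
    simp_rw [hXc]
    ring
  have hXv (c) (l : Fin d) : ∑ i, X c i * (v i l : ℝ) = ∑ i, c i * (u i l : ℝ) := by
    rw [Fin.sum_univ_succAbove _ j, Fin.sum_univ_castSucc, hXj, hXl]
    simp_rw [hXc, hu, Pi.sub_apply, Int.cast_sub, mul_sub, Finset.sum_sub_distrib,
      ← Finset.sum_mul]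
    ring
  refine exists_basis_of_saturated u ?_ ?_
  · rw [Fintype.linearIndependent_iff]
    intro g hg i
    have h1 : X (fun i => (g i : ℝ)) = 0 := by
      refine eq_of_sum_smul_eq hv (by rw [hXs]; simp) ?_
      funext l
      rw [sum_smul_toReal_apply, hXv]
      have := congrFun hg l
      simp only [Finset.sum_apply, Pi.smul_apply, smul_eq_mul, Pi.zero_apply] at this
      simp
      exact_mod_cast this
    have h2 := congrFun h1 (j.succAbove i.castSucc)
    rw [hXc, Pi.zero_apply] at h2
    exact_mod_cast h2
  · intro m y hm hmy
    have hm' : (m : ℝ) ≠ 0 := by exact_mod_cast hm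
    obtain ⟨c, hc⟩ := (Submodule.mem_span_range_iff_exists_fun ℤ).mp hmy
    have hl (l : Fin d) : ∑ i, (c i / m : ℝ) * (u i l : ℝ) = y l := by
      have := congrFun hc l
      simp only [Finset.sum_apply, Pi.smul_apply, smul_eq_mul] at this
      have h1 : ∑ i, (c i : ℝ) * (u i l : ℝ) = m * y l := by exact_mod_cast this
      simp_rw [div_mul_eq_mul_div]
      rw [← Finset.sum_div, h1]
      field_simp
    have hmem : X (fun i => (c i / m : ℝ)) ∈ baryLattice v := by
      refine ⟨by rw [hXs]; exact zero_mem _, fun l => ?_⟩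
      rw [hXv, hl]
      exact intCast_mem _ _
    have hint := h _ hmem (hXj _)
    have hint' (i : Fin k) : ∃ a : ℤ, (a : ℝ) = c i / m := by
      have := hint (j.succAbove i.castSucc)
      rw [hXc] at this
      exact mem_ints_iff.mp this
    choose a ha using hint'
    refine (Submodule.mem_span_range_iff_exists_fun ℤ).mpr ⟨a, ?_⟩
    funext l
    have := hl l
    simp_rw [← ha] at this
    simp only [Finset.sum_apply, Pi.smul_apply, smul_eq_mul]
    exact_mod_cast this

end LatticePolytope

/-! ### Isomorphisms and coefficient vectors -/

namespace LatticePolytope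

/-- The coefficients need not sum to 1; the last term corrects for the translation part of φ. -/
theorem affineMap_sum_smul {ι κ κ' : Type*} [Fintype κ] (φ : (ι → ℝ) →ᵃ[ℝ] (κ' → ℝ))
    (x : κ → ℝ) (p : κ → ι → ℝ) :
    φ (∑ i, x i • p i) = ∑ i, x i • φ (p i) + (1 - ∑ i, x i) • φ 0 := by
  have h (y : ι → ℝ) : φ y = φ.linear y + φ 0 := by
    have := φ.map_vadd 0 y
    simpa using this
  rw [h]
  simp_rw [h (p _)]
  simp only [map_sum, map_smul, smul_add, Finset.sum_add_distrib, sub_smul, one_smul,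
    ← Finset.sum_smul]
  abel

/-- A vertex of a simplex is a member of every family which spans the same polytope. -/
theorem exists_eq_of_conv_eq {ι κ κ' : Type*} [Fintype κ] [Fintype κ'] {v : κ → ι → ℤ}
    (hv : AffineIndependent ℝ fun i => toReal (v i)) (z : κ' → ι → ℝ)
    (hz : ∀ k, z k ∈ conv v) {c : κ' → ℝ} (hc : ∀ k, 0 ≤ c k) (hc1 : ∑ k, c k = 1) {i : κ}
    (h : ∑ k, c k • z k = toReal (v i)) : ∃ k, z k = toReal (v i) := by
  classical
  have hz' (k : κ') := mem_conv_iff.mp (hz k)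
  choose μ hμ0 hμ1 hμ using hz'
  -- The averaged barycentric coordinates of the `z k` are concentrated at i; being nonnegative, so
  -- are those of any `z k` with positive weight.
  have hsum : (fun j => ∑ k, c k * μ k j) = Pi.single i 1 := by
    refine eq_of_sum_smul_eq hv ?_ ?_
    · rw [Finset.sum_comm]
      simp_rw [← Finset.mul_sum, hμ1]
      simpa using hc1
    · simp_rw [Finset.sum_smul, mul_smul]
      rw [Finset.sum_comm]
      simp_rw [← Finset.smul_sum, hμ, h]
      simp [Pi.single_apply, ite_smul]
  obtain ⟨k, hk⟩ : ∃ k, 0 < c k := by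
    by_contra! hcon
    have := Finset.sum_nonpos fun k (_ : k ∈ Finset.univ) => hcon k
    linarith
  have hμj (j : κ) (hj : j ≠ i) : μ k j = 0 := by
    have h1 := congrFun hsum j
    simp only [Pi.single_apply, if_neg hj] at h1
    have h2 := (Finset.sum_eq_zero_iff_of_nonneg
      fun k _ => mul_nonneg (hc k) (hμ0 k j)).mp h1 k (Finset.mem_univ k)
    exact (mul_eq_zero.mp h2).resolve_left hk.ne'
  have h1 : μ k i = 1 := by
    rw [← hμ1 k, Finset.sum_eq_single i (fun j _ hj => hμj j hj) (by simp)]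
  refine ⟨k, ?_⟩
  rw [← hμ k, Finset.sum_eq_single i (fun j _ hj => by rw [hμj j hj, zero_smul]) (by simp), h1,
    one_smul]

theorem affineSpan_conv_eq_top {v : Fin 6 → Fin 5 → ℤ}
    (hv : AffineIndependent ℝ fun i => toReal (v i)) : affineSpan ℝ (conv v) = ⊤ := by
  rw [conv, affineSpan_convexHull, hv.affineSpan_eq_top_iff_card_eq_finrank_add_one]
  simp

/-- Isomorphic polytopes with six vertices have the same lattice of coefficient vectors. -/
theorem Isomorphic.exists_equiv {κ ι : Type*} [Fintype κ] {v : Fin 6 → Fin 5 → ℤ}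
    (hv : AffineIndependent ℝ fun i => toReal (v i)) (hκ : Fintype.card κ = 6) {u : κ → ι → ℤ}
    (h : Isomorphic (conv v) (conv u)) :
    ∃ σ : κ ≃ Fin 6, ∀ x, x ∈ baryLattice v ↔ x ∘ σ ∈ baryLattice u := by
  obtain ⟨φ, hinj, himg, hlat⟩ := h
  rw [affineSpan_conv_eq_top hv] at hinj hlat
  replace hinj : Function.Injective φ := by simpa [Set.injOn_univ] using hinj
  replace hlat (x : Fin 5 → ℝ) : φ x ∈ lattice ι ↔ x ∈ lattice (Fin 5) := hlat x trivial
  have hu (k : κ) : ∃ z ∈ conv v, φ z = toReal (u k) := by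
    have : toReal (u k) ∈ conv u := subset_convexHull ℝ _ ⟨k, rfl⟩
    rwa [← himg] at this
  choose z hz hzu using hu
  have hvert (i : Fin 6) : ∃ k, φ (toReal (v i)) = toReal (u k) := by
    have h1 : φ (toReal (v i)) ∈ conv u := by
      rw [← himg]
      exact ⟨_, subset_convexHull ℝ _ ⟨i, rfl⟩, rfl⟩
    obtain ⟨c, hc, hc1, hcv⟩ := mem_conv_iff.mp h1
    obtain ⟨k, hk⟩ := exists_eq_of_conv_eq hv z hz hc hc1 (i := i) (hinj (by
      rw [affineMap_sum_smul, hc1, sub_self, zero_smul, add_zero]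
      simp_rw [hzu]
      exact hcv))
    exact ⟨k, by rw [← hk, hzu]⟩
  choose τ hτ using hvert
  have hτinj : Function.Injective τ := by
    intro i j hij
    apply hv.injective
    apply hinj
    change φ (toReal (v i)) = φ (toReal (v j))
    rw [hτ, hτ, hij]
  set e : Fin 6 ≃ κ :=
    Equiv.ofBijective τ ((Fintype.bijective_iff_injective_and_card τ).mpr ⟨hτinj, by simp [hκ]⟩)
    with he
  refine ⟨e.symm, fun x => ?_⟩
  have hx : x = (x ∘ e.symm) ∘ e := by
    funext i
    simp
  rw [← comp_equiv_mem_baryLattice e (w := u), ← hx, mem_baryLattice_iff_lattice,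
    mem_baryLattice_iff_lattice]
  refine and_congr_right fun hxs => ?_
  obtain ⟨m, hm⟩ := mem_ints_iff.mp hxs
  -- With integral coefficient sum, the correction by a multiple of φ 0 is a lattice vector and does
  -- not affect membership.
  have h0 : φ 0 ∈ lattice ι := (hlat 0).mpr ⟨0, by funext i; simp [toReal]⟩
  have h1 : ∑ i, x i • toReal ((u ∘ e) i) =
      φ (∑ i, x i • toReal (v i)) - (1 - ∑ i, x i) • φ 0 := by
    rw [affineMap_sum_smul, add_sub_cancel_right]
    exact Finset.sum_congr rfl fun i _ => by rw [hτ]; rfl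
  have h2 : (1 - ∑ i, x i) • φ 0 ∈ lattice ι := by
    rw [mem_lattice_iff] at h0 ⊢
    exact fun j => mul_mem (sub_mem (one_mem _) hxs) (h0 j)
  rw [h1, ← hlat]
  rw [mem_lattice_iff] at h2
  rw [mem_lattice_iff, mem_lattice_iff]
  exact forall_congr' fun j => ⟨fun h => sub_mem h (h2 j),
    fun h => by simpa using add_mem h (h2 j)⟩

end LatticePolytope

/-! ### Cayley polytopes of segments and the normal form -/

namespace LatticePolytope

variable {v : Fin 6 → Fin 5 → ℤ}

/-- Two simplices with the same lattice of coefficient vectors are isomorphic. -/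
theorem isomorphic_of_mem_baryLattice_iff {ι : Type*} {w : Fin 6 → ι → ℤ}
    (hv : AffineIndependent ℝ fun i => toReal (v i))
    (hw : AffineIndependent ℝ fun i => toReal (w i))
    (h : ∀ x, x ∈ baryLattice v ↔ x ∈ baryLattice w) : Isomorphic (conv v) (conv w) := by
  have htop : affineSpan ℝ (Set.range fun i => toReal (v i)) = ⊤ := by
    rw [hv.affineSpan_eq_top_iff_card_eq_finrank_add_one]
    simp
  let b : AffineBasis (Fin 6) ℝ (Fin 5 → ℝ) := ⟨fun i => toReal (v i), hv, htop⟩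
  have hb (y : Fin 5 → ℝ) : ∑ i, b.coords y i • toReal (v i) = y :=
    b.linear_combination_coord_eq_self y
  have hb1 (y : Fin 5 → ℝ) : ∑ i, b.coords y i = 1 := b.sum_coord_apply_eq_one y
  let φ : (Fin 5 → ℝ) →ᵃ[ℝ] (ι → ℝ) :=
    (Fintype.linearCombination ℝ fun i => toReal (w i)).toAffineMap.comp b.coords
  have hφ (y : Fin 5 → ℝ) : φ y = ∑ i, b.coords y i • toReal (w i) := by
    simp [φ, Fintype.linearCombination_apply]
  have hφx (x : Fin 6 → ℝ) (hx : ∑ i, x i = 1) :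
      φ (∑ i, x i • toReal (v i)) = ∑ i, x i • toReal (w i) := by
    have : b.coords (∑ i, x i • toReal (v i)) = x :=
      eq_of_sum_smul_eq hv ((hb1 _).trans hx.symm) (hb _)
    rw [hφ, this]
  refine ⟨φ, ?_, ?_, ?_⟩
  · intro y _ z _ hyz
    rw [hφ, hφ] at hyz
    have := eq_of_sum_smul_eq hw ((hb1 y).trans (hb1 z).symm) hyz
    rw [← hb y, ← hb z, this]
  · ext z
    rw [mem_conv_iff]
    constructor
    · rintro ⟨y, hy, rfl⟩
      obtain ⟨x, hx0, hx1, rfl⟩ := mem_conv_iff.mp hy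
      exact ⟨x, hx0, hx1, (hφx x hx1).symm⟩
    · rintro ⟨x, hx0, hx1, rfl⟩
      exact ⟨_, mem_conv_iff.mpr ⟨x, hx0, hx1, rfl⟩, hφx x hx1⟩
  · intro y _
    have h1 : ∑ i, b.coords y i ∈ ints := by
      rw [hb1]; exact one_mem _
    have h2 := h (b.coords y)
    rw [mem_baryLattice_iff_lattice, mem_baryLattice_iff_lattice, hb y, ← hφ] at h2
    exact ⟨fun h3 => (h2.mpr ⟨h1, h3⟩).2, fun h3 => (h2.mp ⟨h1, h3⟩).2⟩

/-- The vertices of the Cayley polytope of lattice segments. -/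
def cayleyVertices {r d : ℕ} (p q : Fin r → Fin d → ℤ) : Fin r ⊕ Fin r → Fin r ⊕ Fin d → ℤ :=
  Sum.elim (fun i => Sum.elim (Pi.single i 1) (p i)) (fun i => Sum.elim (Pi.single i 1) (q i))

theorem toReal_sumElim_single {r d : ℕ} (i : Fin r) (p : Fin d → ℤ) :
    toReal (Sum.elim (Pi.single i 1) p) = Sum.elim (Pi.single i (1 : ℝ)) (toReal p) := by
  funext j
  rcases j with j | j
  · by_cases h : j = i
    · subst h; simp [toReal]
    · simp [toReal, h]
  · rfl

theorem cayley_latticeSegment {r d : ℕ} (p q : Fin r → Fin d → ℤ) :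
    cayley (fun i => latticeSegment (p i) (q i)) = conv (cayleyVertices p q) := by
  refine Set.Subset.antisymm (convexHull_min ?_ (convex_convexHull ℝ _)) (convexHull_mono ?_)
  · refine Set.iUnion_subset fun i => ?_
    rintro _ ⟨x, ⟨a, b, ha, hb, hab, rfl⟩, rfl⟩
    have h1 : toReal (cayleyVertices p q (Sum.inl i)) ∈ conv (cayleyVertices p q) :=
      subset_convexHull ℝ _ ⟨_, rfl⟩
    have h2 : toReal (cayleyVertices p q (Sum.inr i)) ∈ conv (cayleyVertices p q) :=
      subset_convexHull ℝ _ ⟨_, rfl⟩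
    have h3 := (convex_convexHull ℝ _) h1 h2 ha hb hab
    refine Set.mem_of_eq_of_mem ?_ h3
    simp only [cayleyVertices, Sum.elim_inl, Sum.elim_inr, toReal_sumElim_single]
    funext j
    rcases j with j | j
    · simp [← add_mul, hab]
    · simp
  · rintro _ ⟨i | i, rfl⟩
    · refine Set.mem_iUnion.mpr ⟨i, toReal (p i), left_mem_segment ℝ _ _, ?_⟩
      simp [cayleyVertices, toReal_sumElim_single]
    · refine Set.mem_iUnion.mpr ⟨i, toReal (q i), right_mem_segment ℝ _ _, ?_⟩
      simp [cayleyVertices, toReal_sumElim_single]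

/-- The coordinates in the unit vector directions are exactly the pair sums; their integrality
already implies that of the total. -/
theorem mem_baryLattice_cayleyVertices_iff {r d : ℕ} {p q : Fin r → Fin d → ℤ}
    {x : Fin r ⊕ Fin r → ℝ} :
    x ∈ baryLattice (cayleyVertices p q) ↔
      (∀ i, x (Sum.inl i) + x (Sum.inr i) ∈ ints) ∧
        ∀ l, ∑ i, (x (Sum.inl i) * p i l + x (Sum.inr i) * q i l) ∈ ints := by
  have h1 (j : Fin r) : ∑ i, x i * (cayleyVertices p q i (Sum.inl j) : ℝ) =
      x (Sum.inl j) + x (Sum.inr j) := by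
    simp [cayleyVertices, Pi.single_apply]
  have h2 (l : Fin d) : ∑ i, x i * (cayleyVertices p q i (Sum.inr l) : ℝ) =
      ∑ i, (x (Sum.inl i) * p i l + x (Sum.inr i) * q i l) := by
    simp [cayleyVertices, Finset.sum_add_distrib]
  rw [mem_baryLattice_iff, Sum.forall]
  simp_rw [h1, h2]
  refine ⟨fun h => h.2, fun h => ⟨?_, h⟩⟩
  rw [Fintype.sum_sum_type, ← Finset.sum_add_distrib]
  exact sum_mem fun i _ => h.1 i

/-- A simplex isomorphic to a Cayley polytope of segments is balanced as soon as no coordinate of a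
nontrivial coefficient vector vanishes. -/
theorem balanced_of_cayley {p q : Fin 3 → Fin 3 → ℤ} (σ : Fin 3 ⊕ Fin 3 ≃ Fin 6)
    (hσ : ∀ x, x ∈ baryLattice v ↔ x ∘ σ ∈ baryLattice (cayleyVertices p q))
    (h : ∀ x ∈ baryLattice v, (∀ i, 0 ≤ x i) → (∀ i, x i < 1) → ∀ j, x j = 0 → x = 0) :
    Balanced v := by
  intro x hx h0 h1 hne
  have hpos (i : Fin 6) : 0 < x i := (h0 i).lt_of_ne fun hi => hne (h x hx h0 h1 i hi.symm)
  -- An integer strictly between 0 and 2.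
  have hpair (i : Fin 3) : x (σ (Sum.inl i)) + x (σ (Sum.inr i)) = 1 := by
    obtain ⟨k, hk⟩ := mem_ints_iff.mp ((mem_baryLattice_cayleyVertices_iff.mp ((hσ x).mp hx)).1 i)
    simp only [Function.comp_apply] at hk
    have h2 : (0 : ℝ) < k := by rw [hk]; linarith [hpos (σ (Sum.inl i)), hpos (σ (Sum.inr i))]
    have h3 : (k : ℝ) < 2 := by rw [hk]; linarith [h1 (σ (Sum.inl i)), h1 (σ (Sum.inr i))]
    have h4 : 0 < k := by exact_mod_cast h2
    have h5 : k < 2 := by exact_mod_cast h3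
    have h6 : k = 1 := by omega
    rw [← hk, h6, Int.cast_one]
  rw [← Equiv.sum_comp σ, Fintype.sum_sum_type, ← Finset.sum_add_distrib]
  simp_rw [hpair]
  simp

theorem balanced_of_facetsBasic (hv : AffineIndependent ℝ fun i => toReal (v i))
    (hb : FacetsBasic v) {p q : Fin 3 → Fin 3 → ℤ}
    (h : Isomorphic (conv v) (cayley fun i => latticeSegment (p i) (q i))) : Balanced v := by
  rw [cayley_latticeSegment] at h
  obtain ⟨σ, hσ⟩ := h.exists_equiv hv (by simp)
  refine balanced_of_cayley σ hσ fun x hx h0 h1 j hj => ?_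
  funext i
  exact eq_zero_of_mem_ints ((hb j).mem_ints hx hj i) (h0 i) (h1 i)

/-- The end points of the segments in the definition of `whiteSimplex`. -/
def whiteEndpoints (a₁ a₂ n : ℤ) : Fin 3 → Fin 3 → ℤ := ![![1, 0, 0], ![0, 1, 0], ![a₁, a₂, n]]

theorem whiteSimplex_eq_cayley (a₁ a₂ n : ℤ) :
    whiteSimplex a₁ a₂ n = cayley fun i => latticeSegment 0 (whiteEndpoints a₁ a₂ n i) := by
  rw [whiteSimplex]
  congr 1
  funext i
  fin_cases i <;> rfl

theorem mem_baryLattice_white_iff {a₁ a₂ n : ℤ} {x : Fin 3 ⊕ Fin 3 → ℝ} :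
    x ∈ baryLattice (cayleyVertices 0 (whiteEndpoints a₁ a₂ n)) ↔
      (∀ i, x (Sum.inl i) + x (Sum.inr i) ∈ ints) ∧
        x (Sum.inr 0) + x (Sum.inr 2) * a₁ ∈ ints ∧ x (Sum.inr 1) + x (Sum.inr 2) * a₂ ∈ ints ∧
          x (Sum.inr 2) * n ∈ ints := by
  rw [mem_baryLattice_cayleyVertices_iff]
  simp [Fin.forall_fin_succ, Fin.sum_univ_succ, whiteEndpoints]

theorem mem_ints_of_mul_mem {a n : ℤ} (h : IsCoprime a n) {x : ℝ} (ha : x * a ∈ ints)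
    (hn : x * n ∈ ints) : x ∈ ints := by
  obtain ⟨r, s, hrs⟩ := h
  have h1 : (r : ℝ) * a + s * n = 1 := by exact_mod_cast hrs
  have h2 : x = r * (x * a) + s * (x * n) := by linear_combination (-x) * h1
  rw [h2]
  exact add_mem (mul_mem (intCast_mem _ _) ha) (mul_mem (intCast_mem _ _) hn)

/-- Integrality of one coordinate spreads: within a pair through the pair sum, to the last segment
because a₁ and a₂ are prime to n, and from there to all coordinates. So a box point with a zero
coordinate is zero. -/
theorem balanced_of_isomorphic_whiteSimplex (hv : AffineIndependent ℝ fun i => toReal (v i))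
    {a₁ a₂ n : ℤ} (hc : IsCoprime (a₁ * a₂) n)
    (h : Isomorphic (conv v) (whiteSimplex a₁ a₂ n)) : Balanced v := by
  rw [whiteSimplex_eq_cayley] at h
  have h' := cayley_latticeSegment 0 (whiteEndpoints a₁ a₂ n)
  simp only [Pi.zero_apply] at h'
  rw [h'] at h
  obtain ⟨σ, hσ⟩ := h.exists_equiv hv (by simp)
  refine balanced_of_cayley σ hσ fun x hx h0 h1 j hj => ?_
  obtain ⟨hst, hx1, hx2, hx3⟩ := mem_baryLattice_white_iff.mp ((hσ x).mp hx)
  simp only [Function.comp_apply] at hst hx1 hx2 hx3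
  have hj0 : x j ∈ ints := by rw [hj]; exact zero_mem _
  have hiff (i : Fin 3) : x (σ (Sum.inl i)) ∈ ints ↔ x (σ (Sum.inr i)) ∈ ints :=
    ⟨fun h => by simpa using sub_mem (hst i) h, fun h => by simpa using sub_mem (hst i) h⟩
  have h2 (i : Fin 3) (hi : x (σ (Sum.inr i)) ∈ ints) : x (σ (Sum.inr 2)) ∈ ints := by
    fin_cases i
    · refine mem_ints_of_mul_mem hc.of_mul_left_left ?_ hx3
      simpa using sub_mem hx1 hi
    · refine mem_ints_of_mul_mem hc.of_mul_left_right ?_ hx3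
      simpa using sub_mem hx2 hi
    · exact hi
  have h3 : x (σ (Sum.inr 2)) ∈ ints := by
    obtain ⟨i, rfl⟩ := σ.surjective j
    rcases i with i | i
    · exact h2 i ((hiff i).mp hj0)
    · exact h2 i hj0
  have h4 (i : Fin 3) : x (σ (Sum.inr i)) ∈ ints := by
    fin_cases i
    · simpa using sub_mem hx1 (mul_mem h3 (intCast_mem _ a₁))
    · simpa using sub_mem hx2 (mul_mem h3 (intCast_mem _ a₂))
    · exact h3
  funext i
  obtain ⟨i, rfl⟩ := σ.surjective i
  refine eq_zero_of_mem_ints ?_ (h0 _) (h1 _)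
  rcases i with i | i
  · exact (hiff i).mpr (h4 i)
  · exact h4 i

theorem affineIndependent_white {a₁ a₂ n : ℤ} (hn : 0 < n) :
    AffineIndependent ℝ fun i => toReal (cayleyVertices 0 (whiteEndpoints a₁ a₂ n) i) := by
  rw [affineIndependent_iff_of_fintype]
  intro x hx hx0
  rw [Finset.weightedVSub_eq_linear_combination _ hx] at hx0
  have h1 (j) := congrFun hx0 j
  simp only [sum_smul_toReal_apply, Pi.zero_apply] at h1
  have hst (i : Fin 3) : x (Sum.inl i) + x (Sum.inr i) = 0 := by
    simpa [cayleyVertices, Pi.single_apply] using h1 (Sum.inl i)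
  have h2 : x (Sum.inr 2) = 0 := by
    have := h1 (Sum.inr 2)
    simpa [cayleyVertices, whiteEndpoints, Fin.sum_univ_succ, hn.ne'] using this
  have hr : ∀ i : Fin 3, x (Sum.inr i) = 0 := by
    have h3 := h1 (Sum.inr 0)
    have h4 := h1 (Sum.inr 1)
    simp [cayleyVertices, whiteEndpoints, Fin.sum_univ_succ, h2] at h3 h4
    intro i
    fin_cases i
    · exact h3
    · exact h4
    · exact h2
  rintro (i | i)
  · simpa [hr i] using hst i
  · exact hr i

/-- The coefficient vectors of a balanced simplex are, modulo integral ones, the multiples of a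
vector `c / n` with all `c i` prime to `n`. -/
theorem Balanced.exists_generator (h : Balanced v)
    (hv : AffineIndependent ℝ fun i => toReal (v i)) :
    ∃ (n : ℕ) (c : Fin 6 → ℤ), 0 < n ∧ (∀ i, IsCoprime (c i) n) ∧
      ∀ x, x ∈ baryLattice v ↔ ∃ k : ℤ, ∀ i, x i - k * (c i / n : ℝ) ∈ ints := by
  obtain ⟨N, hN, hden⟩ := exists_denominator hv
  have hN' : (N : ℝ) ≠ 0 := by exact_mod_cast hN.ne'
  -- The values N·x 0 on the coefficient lattice. Coordinate 0 determines x modulo ℤ⁶ by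
  -- `Balanced.mem_ints`, so a generator of this cyclic group lifts to a generator g modulo ℤ⁶, and
  -- n is the absolute value of m in m·g 0 = 1.
  let K : AddSubgroup ℤ :=
    ((baryLattice v).map ((Pi.evalAddMonoidHom (fun _ : Fin 6 => ℝ) 0))).comap
      ((AddMonoidHom.mulRight (N : ℝ)⁻¹).comp (Int.castAddHom ℝ))
  have hK (m : ℤ) : m ∈ K ↔ ∃ x ∈ baryLattice v, x 0 = m * (N : ℝ)⁻¹ := by
    simp [K, AddSubgroup.mem_map]
  obtain ⟨d, hd⟩ := Int.subgroup_cyclic K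
  have hKd (m : ℤ) : m ∈ K ↔ ∃ k : ℤ, k * d = m := by
    rw [hd, AddSubgroup.mem_closure_singleton]
    simp
  obtain ⟨m, hm⟩ := (hKd N).mp ((hK N).mpr ⟨Pi.single 0 1,
    mem_baryLattice_of_mem_ints fun i => by
      rw [Pi.single_apply]
      split_ifs
      exacts [one_mem _, zero_mem _], by simp [hN']⟩)
  have hmR : (m : ℝ) * d = N := by exact_mod_cast hm
  have hm0 : m ≠ 0 := by
    rintro rfl
    simp at hm
    omega
  have hm0' : (m : ℝ) ≠ 0 := by exact_mod_cast hm0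
  obtain ⟨g, hg, hg0⟩ := (hK d).mp ((hKd d).mpr ⟨1, one_mul d⟩)
  have hg0' : m * g 0 = 1 := by
    rw [hg0, ← mul_assoc, hmR, mul_inv_cancel₀ hN']
  have hsmul (k : ℤ) : (fun i => (k : ℝ) * g i) ∈ baryLattice v := by
    have := zsmul_mem hg k
    convert this using 1
    funext i
    simp
  have hint (i : Fin 6) : ((m.natAbs : ℕ) : ℝ) * g i ∈ ints := by
    have h1 := h.mem_ints (hsmul m) (j := 0) (by rw [hg0']; exact one_mem _) i
    have habs : ((m.natAbs : ℕ) : ℝ) = |(m : ℝ)| := by simp [Nat.cast_natAbs]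
    rw [habs]
    rcases abs_choice (m : ℝ) with h2 | h2 <;> rw [h2]
    · exact h1
    · rw [neg_mul]
      exact neg_mem h1
  have hint' (i : Fin 6) := mem_ints_iff.mp (hint i)
  choose c hc using hint'
  set n := m.natAbs with hn
  have hn0 : 0 < n := Int.natAbs_pos.mpr hm0
  have hn' : (n : ℝ) ≠ 0 := by exact_mod_cast hn0.ne'
  have hcg (i : Fin 6) : (c i : ℝ) / n = g i := by
    rw [hc, mul_div_cancel_left₀ _ hn']
  refine ⟨n, c, hn0, fun i => ?_, fun x => ?_⟩
  -- With e = gcd(c i, n) and n = e b, the vector b g is integral at i, hence at 0. Thus n divides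
  -- b, and e = 1.
  · obtain ⟨a, ha⟩ := Int.gcd_dvd_left (c i) n
    obtain ⟨b, hb⟩ := Int.gcd_dvd_right (c i) n
    rw [Int.isCoprime_iff_gcd_eq_one]
    set e := Int.gcd (c i) n with he
    have hb0 : b ≠ 0 := by
      rintro rfl
      simp at hb
      omega
    have he0 : (e : ℝ) ≠ 0 := by
      intro h0
      have h1 : e = 0 := by exact_mod_cast h0
      rw [h1] at hb
      simp at hb
      omega
    have hb0' : (b : ℝ) ≠ 0 := by exact_mod_cast hb0
    have hbR : (n : ℝ) = e * b := by exact_mod_cast hb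
    have haR : (c i : ℝ) = e * a := by exact_mod_cast ha
    have h1 := h.mem_ints (hsmul b) (j := i) (by
      have : (b : ℝ) * g i = a := by
        rw [← hcg, haR, hbR]
        field_simp
      rw [this]
      exact intCast_mem _ _) 0
    obtain ⟨l, hl⟩ := mem_ints_iff.mp h1
    have h2 : m * l = b := by
      have : (m : ℝ) * l = b := by
        rw [hl]
        linear_combination (b : ℝ) * hg0'
      exact_mod_cast this
    have h3 : (n : ℤ) ∣ b := by
      rw [hn, Int.natAbs_dvd]
      exact ⟨l, h2.symm⟩
    rw [hb] at h3
    have h4 : (e : ℤ) * b ∣ 1 * b := by rwa [one_mul]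
    have h5 := Int.dvd_of_mul_dvd_mul_right hb0 h4
    have h6 : (e : ℤ) ∣ ((1 : ℕ) : ℤ) := by exact_mod_cast h5
    exact Nat.dvd_one.mp (Int.natCast_dvd_natCast.mp h6)
  · simp_rw [hcg]
    constructor
    · intro hx
      obtain ⟨l, hl⟩ := mem_ints_iff.mp (hden x hx 0)
      obtain ⟨k, hk⟩ := (hKd l).mp ((hK l).mpr ⟨x, hx, by rw [hl]; field_simp⟩)
      refine ⟨k, h.mem_ints (sub_mem hx (hsmul k)) (j := 0) ?_⟩
      have h1 : x 0 - k * g 0 = 0 := by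
        have hkR : (k : ℝ) * d = N * x 0 := by rw [← hl]; exact_mod_cast hk
        rw [hg0, ← mul_assoc, hkR]
        field_simp
        ring
      change x 0 - k * g 0 ∈ ints
      rw [h1]
      exact zero_mem _
    · rintro ⟨k, hk⟩
      have := add_mem (mem_baryLattice_of_mem_ints (w := v) hk) (hsmul k)
      have e : x = (fun i => x i - k * g i) + fun i => k * g i := by
        funext i
        simp
      rw [e]
      exact this

/-- A balanced simplex is isomorphic to one of the simplices `Δ(a₁, a₂, n)`. -/
theorem Balanced.exists_isomorphic_whiteSimplex (h : Balanced v)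
    (hv : AffineIndependent ℝ fun i => toReal (v i)) :
    ∃ a₁ a₂ n : ℤ, 0 < n ∧ IsCoprime (a₁ * a₂) n ∧
      Isomorphic (conv v) (whiteSimplex a₁ a₂ n) := by
  obtain ⟨n, c, hn, hc, hL⟩ := h.exists_generator hv
  have hn' : (n : ℝ) ≠ 0 := by exact_mod_cast hn.ne'
  obtain ⟨σ, hσ⟩ := exists_pairing_of_sum_fract_eq n hn c hc fun k hk => by
    have hmem : (fun i => ((k * c i : ℤ) / (n : ℝ))) ∈ baryLattice v := by
      refine (hL _).mpr ⟨k, fun i => ?_⟩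
      push_cast
      rw [mul_div_assoc, sub_self]
      exact zero_mem _
    refine h.sum_fract hmem (j := 0) fun h0 => hk ?_
    obtain ⟨m, hm⟩ := mem_ints_iff.mp h0
    have h1 : m * (n : ℤ) = k * c 0 := by
      rw [eq_div_iff hn'] at hm
      exact_mod_cast hm
    exact (hc 0).symm.dvd_of_dvd_mul_right (Dvd.intro_left m h1)
  have hdiv {a : ℤ} (ha : (n : ℤ) ∣ a) : (a : ℝ) / n ∈ ints := by
    obtain ⟨b, rfl⟩ := ha
    push_cast
    rw [mul_div_cancel_left₀ _ hn']
    exact intCast_mem _ _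
  obtain ⟨γ, δ, hγ⟩ := hc (σ (Sum.inr 2))
  have hγn : IsCoprime γ n := ⟨c (σ (Sum.inr 2)), δ, by linear_combination hγ⟩
  -- As γ inverts c (σ (inr 2)) mod n, this choice makes c (σ (inr i)) + a i · c (σ (inr 2))
  -- divisible by n, as the first two conditions on the normal form require.
  set a : Fin 3 → ℤ := fun i => -(c (σ (Sum.inr i)) * γ) with ha
  have hac (i : Fin 3) : IsCoprime (a i) n := ((hc _).mul_left hγn).neg_left
  have hγR : (γ : ℝ) * c (σ (Sum.inr 2)) + δ * n = 1 := by exact_mod_cast hγ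
  refine ⟨a 0, a 1, n, by exact_mod_cast hn, (hac 0).mul_left (hac 1), ?_⟩
  have hmem (x : Fin 6 → ℝ) : x ∈ baryLattice v ↔
      x ∘ σ ∈ baryLattice (cayleyVertices 0 (whiteEndpoints (a 0) (a 1) n)) := by
    rw [hL, mem_baryLattice_white_iff]
    simp only [Function.comp_apply]
    constructor
    · rintro ⟨k, hk⟩
      have hcop (i : Fin 3) : x (σ (Sum.inr i)) + x (σ (Sum.inr 2)) * a i ∈ ints := by
        have h1 : x (σ (Sum.inr i)) + x (σ (Sum.inr 2)) * a i =
            (x (σ (Sum.inr i)) - k * (c (σ (Sum.inr i)) / n : ℝ)) +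
              (x (σ (Sum.inr 2)) - k * (c (σ (Sum.inr 2)) / n : ℝ)) * a i +
                ((k * c (σ (Sum.inr i)) * δ : ℤ) : ℝ) := by
          rw [ha]
          push_cast
          field_simp
          linear_combination (-k * c (σ (Sum.inr i)) : ℝ) * hγR
        rw [h1]
        exact add_mem (add_mem (hk _) (mul_mem (hk _) (intCast_mem _ _))) (intCast_mem _ _)
      refine ⟨fun i => ?_, hcop 0, hcop 1, ?_⟩
      · have h1 := add_mem (add_mem (hk (σ (Sum.inl i))) (hk (σ (Sum.inr i))))
          (mul_mem (intCast_mem ints k) (hdiv (hσ i)))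
        convert h1 using 1
        push_cast
        ring
      · have h1 := add_mem (mul_mem (hk (σ (Sum.inr 2))) (natCast_mem ints n))
          (intCast_mem ints (k * c (σ (Sum.inr 2))))
        convert h1 using 1
        push_cast
        field_simp
        ring
    · rintro ⟨hst, hx1, hx2, hx3⟩
      obtain ⟨m, hm⟩ := mem_ints_iff.mp hx3
      have hm' : (m : ℝ) / n = x (σ (Sum.inr 2)) := by
        rw [hm]
        push_cast
        field_simp
      -- The last coordinate is m/n, and mγ·c (σ (inr 2)) ≡ m mod n.
      refine ⟨m * γ, ?_⟩
      have hcop (i : Fin 3) (hi : x (σ (Sum.inr i)) + x (σ (Sum.inr 2)) * a i ∈ ints) :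
          x (σ (Sum.inr i)) - ((m * γ : ℤ) : ℝ) * (c (σ (Sum.inr i)) / n : ℝ) ∈ ints := by
        convert hi using 1
        rw [← hm', ha]
        push_cast
        ring
      have h2 : x (σ (Sum.inr 2)) - ((m * γ : ℤ) : ℝ) * (c (σ (Sum.inr 2)) / n : ℝ) ∈ ints := by
        have h1 : x (σ (Sum.inr 2)) - ((m * γ : ℤ) : ℝ) * (c (σ (Sum.inr 2)) / n : ℝ) =
            ((m * δ : ℤ) : ℝ) := by
          rw [← hm']
          push_cast
          field_simp
          linear_combination (-m : ℝ) * hγR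
        rw [h1]
        exact intCast_mem _ _
      have hr (i : Fin 3) :
          x (σ (Sum.inr i)) - ((m * γ : ℤ) : ℝ) * (c (σ (Sum.inr i)) / n : ℝ) ∈ ints := by
        fin_cases i
        · exact hcop 0 hx1
        · exact hcop 1 hx2
        · exact h2
      intro i
      obtain ⟨i, rfl⟩ := σ.surjective i
      rcases i with i | i
      · have h1 := sub_mem (sub_mem (hst i) (hr i))
          (mul_mem (intCast_mem ints (m * γ)) (hdiv (hσ i)))
        convert h1 using 1
        push_cast
        ring
      · exact hr i
  have hconv : whiteSimplex (a 0) (a 1) n =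
      conv (cayleyVertices 0 (whiteEndpoints (a 0) (a 1) n) ∘ σ.symm) := by
    have h' := cayley_latticeSegment 0 (whiteEndpoints (a 0) (a 1) n)
    simp only [Pi.zero_apply] at h'
    rw [whiteSimplex_eq_cayley, h', conv, conv]
    congr 1
    exact (σ.symm.surjective.range_comp
      (fun i => toReal (cayleyVertices 0 (whiteEndpoints (a 0) (a 1) n) i))).symm
  rw [hconv]
  refine isomorphic_of_mem_baryLattice_iff hv
    ((affineIndependent_white (by exact_mod_cast hn)).comp_embedding σ.symm.toEmbedding)
    fun x => ?_
  rw [hmem, ← comp_equiv_mem_baryLattice σ]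
  simp [Function.comp_def]

theorem Balanced.facetsBasic (h : Balanced v) (hv : AffineIndependent ℝ fun i => toReal (v i)) :
    FacetsBasic v := fun j =>
  basicSimplex_of_mem_ints hv j fun _ hx hj =>
    h.mem_ints hx (j := j) (by rw [hj]; exact zero_mem _)

end LatticePolytope

/-! ### The equivalences -/

theorem mainTheorem7 (v : Fin 6 → Fin 5 → ℤ)
    (hv : AffineIndependent ℝ fun i => LatticePolytope.toReal (v i)) :
    List.TFAE [
      LatticePolytope.EmptySimplex v ∧ LatticePolytope.DoubleOnlyVerticesAndMidpoints v,
      ∃ n : ℤ, 1 ≤ n ∧ LatticePolytope.hStar (LatticePolytope.conv v) =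
        1 + PowerSeries.C (n - 1) * PowerSeries.X ^ 3,
      LatticePolytope.FacetsBasic v ∧ ∃ p q : Fin 3 → Fin 3 → ℤ, (∀ i, p i ≠ q i) ∧
        LatticePolytope.Isomorphic (LatticePolytope.conv v)
          (LatticePolytope.cayley fun i => LatticePolytope.latticeSegment (p i) (q i)),
      ∃ a₁ a₂ n : ℤ, 0 < n ∧ IsCoprime (a₁ * a₂) n ∧
        LatticePolytope.Isomorphic (LatticePolytope.conv v)
          (LatticePolytope.whiteSimplex a₁ a₂ n)] := by
  tfae_have 1 → 2 := fun h => (LatticePolytope.balanced_of_emptySimplex hv h.1 h.2).exists_hStar_eq hv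
  tfae_have 2 → 1 := by
    rintro ⟨n, -, hn⟩
    obtain ⟨h1, h2⟩ := LatticePolytope.ncard_eq_of_hStar_eq hn
    exact ⟨LatticePolytope.emptySimplex_of_ncard_eq hv h1, LatticePolytope.doubleOnlyVerticesAndMidpoints_of_ncard_eq hv h2⟩
  tfae_have 1 → 4 := fun h =>
    (LatticePolytope.balanced_of_emptySimplex hv h.1 h.2).exists_isomorphic_whiteSimplex hv
  tfae_have 4 → 3 := by
    rintro ⟨a₁, a₂, n, hn, hc, h⟩
    refine ⟨(LatticePolytope.balanced_of_isomorphic_whiteSimplex hv hc h).facetsBasic hv, fun _ => 0,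
      LatticePolytope.whiteEndpoints a₁ a₂ n, fun i hi => ?_, by rwa [LatticePolytope.whiteSimplex_eq_cayley] at h⟩
    fin_cases i
    · simpa [LatticePolytope.whiteEndpoints] using congrFun hi 0
    · simpa [LatticePolytope.whiteEndpoints] using congrFun hi 1
    · exact hn.ne (by simpa [LatticePolytope.whiteEndpoints] using congrFun hi 2)
  tfae_have 3 → 2 := by
    rintro ⟨hb, p, q, -, h⟩
    exact (LatticePolytope.balanced_of_facetsBasic hv hb h).exists_hStar_eq hv
  tfae_finish
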